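/- Let $d\ge 1$ and let $P,Q$ be probability distributions of $(X,Y)$ on $[0,1]^d\times\{0,1\}$, with marginals $P_X,Q_X$ of $X$ and regression functions $\eta_P(x)=P(Y=1\mid X=x)$, $\eta_Q(x)=Q(Y=1\mid X=x)$. Let $\lambda$ be Lebesgue measure on $\mathbb{R}^d$ and $B(x,r)$ the Euclidean ball. For constants $\theta=(\alpha,\beta_P,\beta_Q,\gamma,c_\lambda,r_\lambda,C_\beta,C_\alpha,C_\gamma)$ with $\alpha\ge 0$, $\beta_P,\beta_Q\in[0,1]$, $\max(\beta_P,\beta_Q)>0$ and $\gamma,c_\lambda,r_\lambda,C_\beta,C_\alpha,C_\gamma>0$, let $\Pi(\theta)$ be the set of all pairs $(P,Q)$ for which there are a set $\Omega\subset[0,1]^d$ and versions of $\eta_P,\eta_Q$ such that: 1. $\Omega$ is the support of both $P_X$ and $Q_X$; $\lambda(\Omega\cap B(x,r))\ge c_\lambda\,\lambda(B(x,r))$ for all $x\in\Omega$ and $0<r<r_\lambda$; and $c_\lambda<\frac{dP_X}{d\lambda}(x)<c_\lambda^{-1}$, $c_\lambda<\frac{dQ_X}{d\lambda}(x)<c_\lambda^{-1}$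 for all $x\in\Omega$; 2. $|\eta_P(x_1)-\eta_P(x_2)|\le C_\beta\|x_1-x_2\|^{\beta_P}$ and $|\eta_Q(x_1)-\eta_Q(x_2)|\le C_\beta\|x_1-x_2\|^{\beta_Q}$ for all $x_1,x_2\in\Omega$ (with $0^0=1$); 3. $Q_X(|\eta_Q(X)-1/2|<t)\le C_\alpha t^{\alpha}$ for all $t\in(0,1/2]$; 4. $(\eta_P(x)-1/2)(\eta_Q(x)-1/2)\ge 0$ and $|\eta_P(x)-1/2|\ge C_\gamma|\eta_Q(x)-1/2|^{\gamma}$ for all $x\in\Omega$. For a classifier $\widehat f$ constructed on $n_P$ i.i.d. observations from $P$ only (so $n_Q=0$), let $\mathcal R_Q(\widehat f)=\mathbb E\,Q(\widehat f(X)\ne Y)-Q(f_Q^*(X)\ne Y)$ be its excess risk under $Q$, where $\mathbb E$ is over the sample and $f_Q^*=\mathbb I(\eta_Q\ge 1/2)$ is the Bayes classifier. Suppose that $c_\lambda$ is small enough and $C_\alpha$ is large enough; precisely, $c_\lambda\le c_0$, where $c_0>0$ depends only on $d$ and $r_\lambda$, and $C_\alpha\ge C_0$, where $C_0>0$ depends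 only on $d,r_\lambda,\alpha,\beta_P,\beta_Q,\gamma,C_\beta,C_\gamma$. Then: (a) If $\beta_P>\gamma\beta_Q$ and $\alpha\beta_P\le\gamma d$, there is a constant $c>0$ depending only on $\theta$ and $d$ such that, for all $n_P\ge 1$, $$\inf_{\widehat f}\ \sup_{(P,Q)\in\Pi(\theta)}\mathcal R_Q(\widehat f)\ \ge\ c\,n_P^{-\frac{(1+\alpha)\beta_P}{\gamma(2\beta_P+d)}}.$$ (b) If $\beta_P\le\gamma\beta_Q$ and $\alpha\beta_Q\le d$, there is a constant $c>0$ depending only on $\theta$ and $d$ such that, for all $n_P\ge 1$, $$\inf_{\widehat f}\ \sup_{(P,Q)\in\Pi(\theta)}\mathcal R_Q(\widehat f)\ \ge\ c\,n_P^{-\frac{(1+\alpha)\beta_Q}{2\gamma\beta_Q+d}}.$$ The infima are over all (measurable) classifiers constructed on the $P$-data. -/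

import Mathlib

open MeasureTheory ProbabilityTheory

noncomputable section

/-- The Euclidean feature space `ℝ^d`; the features take values in the unit cube `[0,1]^d`. -/
abbrev Feature (d : ℕ) : Type := EuclideanSpace ℝ (Fin d)

/-- A labelled observation `(X, Y)`; the label `1` is `true` and the label `0` is `false`. -/
abbrev Obs (d : ℕ) : Type := Feature d × Bool

/-- The unit cube `[0,1]^d`. -/
def unitCube (d : ℕ) : Set (Feature d) := {x | ∀ i, x i ∈ Set.Icc (0 : ℝ) 1}

/-- The marginal distribution of the features. -/
def marginalX {d : ℕ} (P : ProbabilityMeasure (Obs d)) : Measure (Feature d) :=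
  (P : Measure (Obs d)).fst

/-- The regression function `η(x) = P(Y = 1 | X = x)`, from the regular conditional distribution
of `Y` given `X` (determined up to a null set of the marginal of `X`). -/
def regressionFun {d : ℕ} (P : ProbabilityMeasure (Obs d)) (x : Feature d) : ℝ :=
  ((P : Measure (Obs d)).condKernel x).real {true}

/-- `η` is a measurable, `[0,1]`-valued version of the conditional probability
`P(Y = 1 | X = ·)`. -/
structure IsRegressionVersion {d : ℕ} (P : ProbabilityMeasure (Obs d)) (η : Feature d → ℝ) :
    Prop where
  measurable : Measurable η
  mem_Icc : ∀ x, η x ∈ Set.Icc (0 : ℝ) 1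
  ae_eq : η =ᵐ[marginalX P] regressionFun P

/-- The constants `θ = {α, β_P, β_Q, γ, c_λ, r_λ, C_β, C_α, C_γ}`. -/
structure Theta where
  α : ℝ
  βP : ℝ
  βQ : ℝ
  γ : ℝ
  cLam : ℝ
  rLam : ℝ
  Cβ : ℝ
  Cα : ℝ
  Cγ : ℝ

/-- The marginal `μ` has a Lebesgue density lying strictly between `c` and `c⁻¹` on `Ω`. -/
def HasDensityBounds {d : ℕ} (μ : Measure (Feature d)) (Ω : Set (Feature d)) (c : ℝ) : Prop :=
  ∃ f : Feature d → ℝ, Measurable f ∧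
    μ = volume.withDensity (fun x => ENNReal.ofReal (f x)) ∧
    ∀ x ∈ Ω, c < f x ∧ f x < c⁻¹

/-- Common support and strong density: `Ω ⊆ [0,1]^d` is the (topological) support of both
marginals, it is regular, and both marginal densities are bounded away from zero and infinity
on it. -/
structure StrongDensity {d : ℕ} (c r₀ : ℝ) (P Q : ProbabilityMeasure (Obs d))
    (Ω : Set (Feature d)) : Prop where
  subset_cube : Ω ⊆ unitCube d
  support_P : (marginalX P).support = Ω
  support_Q : (marginalX Q).support = Ω
  regular : ∀ x ∈ Ω, ∀ r : ℝ, 0 < r → r < r₀ →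
    ENNReal.ofReal c * volume (Metric.ball x r) ≤ volume (Ω ∩ Metric.ball x r)
  density_P : HasDensityBounds (marginalX P) Ω c
  density_Q : HasDensityBounds (marginalX Q) Ω c

/-- `β`-Hölder smoothness on `Ω` with constant `C` (for `β = 0`: oscillation at most `C`). -/
def HolderSmoothOn {d : ℕ} (C β : ℝ) (η : Feature d → ℝ) (Ω : Set (Feature d)) : Prop :=
  ∀ x₁ ∈ Ω, ∀ x₂ ∈ Ω, |η x₁ - η x₂| ≤ C * ‖x₁ - x₂‖ ^ β

/-- Tsybakov's noise condition with exponent `α` and constant `C`. -/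
def TsybakovNoise {d : ℕ} (C α : ℝ) (μ : Measure (Feature d)) (η : Feature d → ℝ) : Prop :=
  ∀ t : ℝ, 0 < t → t ≤ 1 / 2 → μ.real {x | |η x - 1 / 2| < t} ≤ C * t ^ α

/-- The relative signal exponent condition on `Ω`. -/
def RelativeSignal {d : ℕ} (C γ : ℝ) (ηP ηQ : Feature d → ℝ) (Ω : Set (Feature d)) : Prop :=
  ∀ x ∈ Ω, 0 ≤ (ηP x - 1 / 2) * (ηQ x - 1 / 2) ∧
    C * |ηQ x - 1 / 2| ^ γ ≤ |ηP x - 1 / 2|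

/-- The class `Π(θ)` of pairs `(P, Q)` of distributions on `[0,1]^d × {0,1}`. -/
def DriftClass (d : ℕ) (θ : Theta) :
    Set (ProbabilityMeasure (Obs d) × ProbabilityMeasure (Obs d)) :=
  {PQ | ∃ (Ω : Set (Feature d)) (ηP ηQ : Feature d → ℝ),
    IsRegressionVersion PQ.1 ηP ∧ IsRegressionVersion PQ.2 ηQ ∧
    StrongDensity θ.cLam θ.rLam PQ.1 PQ.2 Ω ∧
    HolderSmoothOn θ.Cβ θ.βP ηP Ω ∧ HolderSmoothOn θ.Cβ θ.βQ ηQ Ω ∧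
    TsybakovNoise θ.Cα θ.α (marginalX PQ.2) ηQ ∧
    RelativeSignal θ.Cγ θ.γ ηP ηQ Ω}

/-- The classification risk `Q(f(X) ≠ Y)` of a classifier `f`. -/
def classRisk {d : ℕ} (Q : ProbabilityMeasure (Obs d)) (f : Feature d → Bool) : ℝ :=
  (Q : Measure (Obs d)).real {z | f z.1 ≠ z.2}

open Classical in
/-- The Bayes classifier `1(η_Q ≥ 1/2)`. -/
def bayesClassifier {d : ℕ} (Q : ProbabilityMeasure (Obs d)) (x : Feature d) : Bool :=
  decide (1 / 2 ≤ regressionFun Q x)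

/-- Classifiers built from a sample of size `n`: jointly measurable maps sending the data and a
new feature to a label. -/
def Classifier (d n : ℕ) : Type :=
  {f : (Fin n → Obs d) → Feature d → Bool // Measurable (Function.uncurry f)}

/-- The excess risk under `Q` of a classifier built from `n` i.i.d. observations from `P`. -/
def excessRisk {d n : ℕ} (P Q : ProbabilityMeasure (Obs d)) (f : Classifier d n) : ℝ :=
  (∫ z, classRisk Q (f.1 z) ∂(Measure.pi fun _ : Fin n => (P : Measure (Obs d))))
    - classRisk Q (bayesClassifier Q)

/-- The minimax excess risk over `Π(θ)` for `n` observations from `P` and none from `Q`. -/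
def minimaxExcessRisk (d n : ℕ) (θ : Theta) : EReal :=
  ⨅ f : Classifier d n, ⨆ PQ ∈ DriftClass d θ, ((excessRisk PQ.1 PQ.2 f : ℝ) : EReal)

end

/-!
Both regimes are instances of one bound. With `β = max (βP / γ) βQ`, the target may be given the
smoothness `β ≥ βQ` and the source the smoothness `γ β ≥ βP`; the condition becomes `α β ≤ d` and
the rate `n ^ (-(1 + α) β / (2 γ β + d))`, which is that of (a) for `β = βP / γ` and that of (b)
for `β = βQ` (`minimaxExcessRisk_ge`).

The lower bound is an Assouad hypercube. Cut `[0,1]^d` into `N ^ d` grid cells and keep the middle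
cube of each; the union `coreCubes N d` of these cores is the common support, and both marginals
are uniform on it. Since the support is a product of one-dimensional sets and occupies the same
proportion of every cell, it is regular uniformly in `N` (`coreCubes_regular`). The regression
functions are constant on the cores: `1/2 ± a h ^ β` for the target and `1/2 ± b h ^ (γ β)` for the
source. In a corner block of `M ^ d` cells `h = 1 / N` and the signs are free; elsewhere the sign
is `+` and `h` is the distance to the block, but at least `1 / N`. The cores of different cells are
separated by half a mesh, so the signed `h` is Lipschitz and its powers are Hölder
(`holderSmoothOn_stepEta`). The signal never falls below `a N ^ (-β)`, and the gaps between the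
cores hold the sign changes. The block has volume `(M / N) ^ d ≈ N ^ (-α β)`, which together with
`α β ≤ d` gives the noise condition (`tsybakovNoise_stepEta`).

Flipping the sign of one cell lowers the Hellinger affinity of one observation by at most
`4 b² N ^ (-(2 γ β + d))` (`one_sub_le_affinity`), so for `N ≈ n ^ (1 / (2 γ β + d))` the sign of a
cell is not determined by the sample (`flip_bound`). A wrong sign on a cell costs
`2 a N ^ (-β) N ^ (-d)`; averaging over all sign vectors, the `M ^ d` cells contribute an excess
risk of order `(M / N) ^ d N ^ (-β) ≈ N ^ (-(1 + α) β)` (`exists_excessRisk_ge`).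
-/

/-! ### Laws of labelled observations -/

section LabelledLaw

/-- The density, with respect to `ν ⊗ counting measure`, of a pair `(x, y)` with `x ∼ ν` and
`P(y = true | x) = η x`. -/
def labelDensity {X : Type*} (η : X → ℝ) (z : X × Bool) : ℝ :=
  if z.2 = true then η z.1 else 1 - η z.1

lemma labelDensity_nonneg {X : Type*} {η : X → ℝ}
    (h01 : ∀ x, η x ∈ Set.Icc (0 : ℝ) 1) (z : X × Bool) :
    0 ≤ labelDensity η z := by
  have := h01 z.1
  unfold labelDensity
  split_ifs <;> linarith [this.1, this.2]

lemma labelDensity_le_one {X : Type*} {η : X → ℝ}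
    (h01 : ∀ x, η x ∈ Set.Icc (0 : ℝ) 1) (z : X × Bool) :
    labelDensity η z ≤ 1 := by
  have := h01 z.1
  unfold labelDensity
  split_ifs <;> linarith [this.1, this.2]

lemma ofReal_labelDensity_add {X : Type*} {η : X → ℝ}
    (h01 : ∀ x, η x ∈ Set.Icc (0 : ℝ) 1) (x : X) :
    ENNReal.ofReal (labelDensity η (x, true)) + ENNReal.ofReal (labelDensity η (x, false)) = 1 := by
  rw [← ENNReal.ofReal_add (labelDensity_nonneg h01 _) (labelDensity_nonneg h01 _)]
  simp [labelDensity]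

variable {X : Type*} [MeasurableSpace X]

/-- The law of a pair `(x, y)` with `x ∼ ν` and `P(y = true | x) = η x`. -/
noncomputable def labelledLaw (ν : Measure X) (η : X → ℝ) : Measure (X × Bool) :=
  (ν.prod Measure.count).withDensity fun z => ENNReal.ofReal (labelDensity η z)

variable {ν : Measure X} {η : X → ℝ}

lemma measurable_labelDensity (hη : Measurable η) : Measurable (labelDensity η) := by
  refine Measurable.ite (measurable_snd (measurableSet_singleton true)) ?_ ?_ <;> fun_prop

lemma lintegral_prod_count [SFinite ν] {F : X × Bool → ENNReal} (hF : Measurable F) :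
    ∫⁻ z, F z ∂(ν.prod Measure.count) = ∫⁻ x, (F (x, true) + F (x, false)) ∂ν := by
  rw [lintegral_prod _ hF.aemeasurable]
  simp [lintegral_count]

lemma labelledLaw_apply [SFinite ν] (hη : Measurable η) {S : Set (X × Bool)}
    (hS : MeasurableSet S) :
    labelledLaw ν η S = ∫⁻ x, (S.indicator (fun z => ENNReal.ofReal (labelDensity η z)) (x, true)
      + S.indicator (fun z => ENNReal.ofReal (labelDensity η z)) (x, false)) ∂ν := by
  rw [labelledLaw, withDensity_apply _ hS, ← lintegral_indicator hS,
    lintegral_prod_count ((measurable_labelDensity hη).ennreal_ofReal.indicator hS)]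

lemma fst_labelledLaw [SFinite ν] (hη : Measurable η) (h01 : ∀ x, η x ∈ Set.Icc (0 : ℝ) 1) :
    (labelledLaw ν η).fst = ν := by
  ext s hs
  rw [Measure.fst_apply hs, labelledLaw_apply hη (measurable_fst hs), ← lintegral_indicator_one hs]
  refine lintegral_congr fun x => ?_
  by_cases hx : x ∈ s
  · simp [Set.indicator, hx, ofReal_labelDensity_add h01]
  · simp [Set.indicator, hx]

lemma isProbabilityMeasure_labelledLaw [IsProbabilityMeasure ν] (hη : Measurable η)
    (h01 : ∀ x, η x ∈ Set.Icc (0 : ℝ) 1) : IsProbabilityMeasure (labelledLaw ν η) := by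
  constructor
  rw [← Measure.fst_univ, fst_labelledLaw hη h01, measure_univ]

lemma condKernel_labelledLaw [IsProbabilityMeasure ν] (hη : Measurable η)
    (h01 : ∀ x, η x ∈ Set.Icc (0 : ℝ) 1) [IsFiniteMeasure (labelledLaw ν η)] :
    (fun x => ((labelledLaw ν η).condKernel x).real {true}) =ᵐ[ν] η := by
  have hm : Measurable (Function.uncurry fun (x : X) (y : Bool) =>
      ENNReal.ofReal (labelDensity η (x, y))) :=
    (measurable_labelDensity hη).ennreal_ofReal
  set κ : Kernel X Bool := Kernel.withDensity (Kernel.const X Measure.count)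
    (fun x y => ENNReal.ofReal (labelDensity η (x, y))) with hκ
  have hκ_apply : ∀ x s, κ x s = ∫⁻ y in s, ENNReal.ofReal (labelDensity η (x, y))
      ∂Measure.count := by
    intro x s
    rw [hκ, Kernel.withDensity_apply' _ hm]
    simp
  have : IsMarkovKernel κ := by
    constructor
    intro x
    constructor
    rw [hκ_apply]
    rw [Measure.restrict_univ, lintegral_count, tsum_fintype, Fintype.sum_bool]
    exact ofReal_labelDensity_add h01 x
  have hcomp : labelledLaw ν η = (labelledLaw ν η).fst ⊗ₘ κ := by
    rw [fst_labelledLaw hη h01, hκ, Measure.compProd_withDensity hm, Measure.compProd_const]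
    rfl
  have h := eq_condKernel_of_measure_eq_compProd κ hcomp
  rw [fst_labelledLaw hη h01] at h
  filter_upwards [h] with x hx
  rw [← hx, Measure.real, hκ_apply]
  simp [labelDensity, (h01 x).1]

end LabelledLaw

/-- The law of a labelled observation with feature law `ν` and regression function `η`. -/
noncomputable def obsLaw {d : ℕ} (ν : Measure (Feature d)) [IsProbabilityMeasure ν]
    (η : Feature d → ℝ) (hη : Measurable η) (h01 : ∀ x, η x ∈ Set.Icc (0 : ℝ) 1) :
    ProbabilityMeasure (Obs d) :=
  ⟨labelledLaw ν η, isProbabilityMeasure_labelledLaw hη h01⟩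

section ObsLaw

variable {d : ℕ} {ν : Measure (Feature d)} [IsProbabilityMeasure ν] {η : Feature d → ℝ}
  (hη : Measurable η) (h01 : ∀ x, η x ∈ Set.Icc (0 : ℝ) 1)

lemma marginalX_obsLaw : marginalX (obsLaw ν η hη h01) = ν :=
  fst_labelledLaw hη h01

lemma regressionFun_obsLaw : regressionFun (obsLaw ν η hη h01) =ᵐ[ν] η := by
  have := isProbabilityMeasure_labelledLaw (ν := ν) hη h01
  exact condKernel_labelledLaw hη h01

lemma isRegressionVersion_obsLaw : IsRegressionVersion (obsLaw ν η hη h01) η :=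
  ⟨hη, h01, by rw [marginalX_obsLaw]; exact (regressionFun_obsLaw hη h01).symm⟩

lemma classRisk_obsLaw {g : Feature d → Bool} (hg : Measurable g) :
    classRisk (obsLaw ν η hη h01) g = ∫ x, (if g x = true then 1 - η x else η x) ∂ν := by
  have hS : MeasurableSet {z : Obs d | g z.1 ≠ z.2} :=
    (measurableSet_eq_fun (hg.comp measurable_fst) measurable_snd).compl
  have hmeas : Measurable fun x => if g x = true then 1 - η x else η x :=
    Measurable.ite (hg (measurableSet_singleton true)) (by fun_prop) hη
  change (labelledLaw ν η).real _ = _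
  rw [integral_eq_lintegral_of_nonneg_ae (Filter.Eventually.of_forall fun x => ?_)
    hmeas.aestronglyMeasurable, Measure.real, labelledLaw_apply hη hS]
  · congr 1
    refine lintegral_congr fun x => ?_
    cases h : g x <;> simp [Set.indicator, h, labelDensity]
  · have := h01 x
    simp only [Pi.zero_apply]
    split_ifs <;> linarith [this.1, this.2]

lemma classRisk_bayesClassifier_obsLaw {g : Feature d → Bool}
    (hgη : ∀ x, g x = true ↔ 1 / 2 ≤ η x) :
    classRisk (obsLaw ν η hη h01) (bayesClassifier (obsLaw ν η hη h01))
      = classRisk (obsLaw ν η hη h01) g := by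
  have hae : ∀ᵐ z ∂(labelledLaw ν η), regressionFun (obsLaw ν η hη h01) z.1 = η z.1 := by
    have h : ∀ᵐ x ∂(labelledLaw ν η).fst, regressionFun (obsLaw ν η hη h01) x = η x :=
      (fst_labelledLaw (ν := ν) hη h01).symm ▸ regressionFun_obsLaw hη h01
    exact ae_of_ae_map measurable_fst.aemeasurable h
  refine measureReal_congr ?_
  change _ =ᵐ[labelledLaw ν η] _
  filter_upwards [hae] with z hz
  have : bayesClassifier (obsLaw ν η hη h01) z.1 = g z.1 := by
    rw [Bool.eq_iff_iff, hgη, bayesClassifier, hz]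
    simp
  change (_ ≠ _) = (_ ≠ _)
  rw [this]

/-- The excess risk is the integral of `|2η - 1|` over the region of disagreement with the Bayes
rule. -/
lemma classRisk_sub_bayes_obsLaw {f g : Feature d → Bool} (hf : Measurable f) (hg : Measurable g)
    (hgη : ∀ x, g x = true ↔ 1 / 2 ≤ η x) :
    classRisk (obsLaw ν η hη h01) f
        - classRisk (obsLaw ν η hη h01) (bayesClassifier (obsLaw ν η hη h01))
      = ∫ x, (if f x = g x then 0 else |2 * η x - 1|) ∂ν := by
  have hint : ∀ {g : Feature d → Bool}, Measurable g →
      Integrable (fun x => if g x = true then 1 - η x else η x) ν := by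
    intro g hg
    have hmeas : Measurable fun x => if g x = true then 1 - η x else η x :=
      Measurable.ite (hg (measurableSet_singleton true)) (by fun_prop) hη
    refine Integrable.of_bound hmeas.aestronglyMeasurable 1
      (Filter.Eventually.of_forall fun x => ?_)
    have := h01 x
    rw [Real.norm_eq_abs, abs_le]
    split_ifs <;> constructor <;> linarith [this.1, this.2]
  rw [classRisk_bayesClassifier_obsLaw hη h01 hgη, classRisk_obsLaw hη h01 hf,
    classRisk_obsLaw hη h01 hg, ← integral_sub (hint hf) (hint hg)]
  refine integral_congr_ae (Filter.Eventually.of_forall fun x => ?_)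
  have h := hgη x
  dsimp only
  by_cases hx : 1 / 2 ≤ η x
  · rw [abs_of_nonneg (by linarith)]
    rw [h.2 hx]
    cases f x <;> simp
    ring
  · have hgx : g x = false := by
      cases hg' : g x
      · rfl
      · exact absurd (h.1 hg') hx
    rw [abs_of_neg (by linarith), hgx]
    cases f x <;> simp
    ring

end ObsLaw

/-! ### Two-point and hypercube testing bounds -/

/-- The `n`-fold power of a measure with density `p` has density `∏ i, p (z i)`. -/
lemma pi_withDensity_ofReal {X : Type*} [MeasurableSpace X] {μ : Measure X} [SigmaFinite μ]
    {p : X → ℝ} (hp : Integrable p μ) (hp0 : ∀ x, 0 ≤ p x) (n : ℕ) :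
    Measure.pi (fun _ : Fin n => μ.withDensity fun x => ENNReal.ofReal (p x))
      = (Measure.pi fun _ : Fin n => μ).withDensity fun z => ENNReal.ofReal (∏ i, p (z i)) := by
  have : IsFiniteMeasure (μ.withDensity fun x => ENNReal.ofReal (p x)) :=
    isFiniteMeasure_withDensity_ofReal hp.2
  refine Measure.pi_eq fun s hs => ?_
  rw [withDensity_apply _ (MeasurableSet.univ_pi hs), Measure.restrict_pi_pi,
    ← ofReal_integral_eq_lintegral_ofReal]
  · rw [integral_fintype_prod_eq_prod (fun _ => p),
      ENNReal.ofReal_prod_of_nonneg fun i _ => integral_nonneg hp0]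
    refine Finset.prod_congr rfl fun i _ => ?_
    rw [withDensity_apply _ (hs i), ofReal_integral_eq_lintegral_ofReal hp.restrict
      (Filter.Eventually.of_forall hp0)]
  · exact Integrable.fintype_prod (f := fun _ => p) fun i => hp.restrict
  · exact Filter.Eventually.of_forall fun z => Finset.prod_nonneg fun i _ => hp0 _

/-- Le Cam's two-point bound: two complementary losses `T₁ + T₂ = W` cannot both have a small
mean under two laws whose Hellinger affinity is at least `1 / 2`. -/
lemma two_point_bound {Z : Type*} [MeasurableSpace Z] {μ : Measure Z} {p q T₁ T₂ : Z → ℝ} {W : ℝ}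
    (hp : Integrable p μ) (hq : Integrable q μ) (hp0 : ∀ z, 0 ≤ p z) (hq0 : ∀ z, 0 ≤ q z)
    (hp1 : ∫ z, p z ∂μ = 1) (hq1 : ∫ z, q z ∂μ = 1)
    (hT₁ : Measurable T₁) (hT₂ : Measurable T₂) (hT₁0 : ∀ z, 0 ≤ T₁ z) (hT₂0 : ∀ z, 0 ≤ T₂ z)
    (hW : ∀ z, T₁ z + T₂ z = W) (hW0 : 0 ≤ W)
    (haff : 1 / 2 ≤ ∫ z, √(p z) * √(q z) ∂μ) :
    W / 8 ≤ ∫ z, p z * T₁ z ∂μ + ∫ z, q z * T₂ z ∂μ := by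
  have hbd : ∀ {T : Z → ℝ} {r : Z → ℝ}, Measurable T → (∀ z, 0 ≤ T z) → (∀ z, T z ≤ W) →
      Integrable r μ → Integrable (fun z => r z * T z) μ := fun hT h0 h1 hr =>
    hr.mul_bdd (c := W) hT.aestronglyMeasurable (Filter.Eventually.of_forall fun z => by
      rw [Real.norm_eq_abs, abs_of_nonneg (h0 z)]; exact h1 z)
  have hi₁ := hbd hT₁ hT₁0 (fun z => by linarith [hW z, hT₂0 z]) hp
  have hi₂ := hbd hT₂ hT₂0 (fun z => by linarith [hW z, hT₁0 z]) hq
  have hs : Integrable (fun z => √(p z) * √(q z)) μ := by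
    refine Integrable.mono' (hp.add hq)
      ((Real.continuous_sqrt.comp_aestronglyMeasurable hp.1).mul
        (Real.continuous_sqrt.comp_aestronglyMeasurable hq.1))
      (Filter.Eventually.of_forall fun z => ?_)
    rw [Real.norm_eq_abs, abs_of_nonneg (by positivity), Pi.add_apply]
    nlinarith [Real.sq_sqrt (hp0 z), Real.sq_sqrt (hq0 z), sq_nonneg (√(p z) - √(q z)),
      hp0 z, hq0 z]
  have key : ∫ z, W * (1 / 2 * (√(p z) * √(q z)) - 1 / 16 * (p z + q z)) ∂μ
      ≤ ∫ z, (p z * T₁ z + q z * T₂ z) ∂μ := by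
    refine integral_mono (((hs.const_mul _).sub ((hp.add hq).const_mul _)).const_mul _)
      (hi₁.add hi₂) fun z => ?_
    dsimp only
    -- `(√p - √q / 4)² ≥ 0` bounds `p` from below, and symmetrically for `q`.
    have h1 : 1 / 2 * (√(p z) * √(q z)) - 1 / 16 * (p z + q z) ≤ p z := by
      nlinarith [Real.sq_sqrt (hp0 z), Real.sq_sqrt (hq0 z), sq_nonneg (√(p z) - √(q z) / 4),
        hp0 z, hq0 z]
    have h2 : 1 / 2 * (√(p z) * √(q z)) - 1 / 16 * (p z + q z) ≤ q z := by
      nlinarith [Real.sq_sqrt (hp0 z), Real.sq_sqrt (hq0 z), sq_nonneg (√(q z) - √(p z) / 4),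
        hp0 z, hq0 z]
    rw [← hW z]
    nlinarith [mul_le_mul_of_nonneg_right h1 (hT₁0 z), mul_le_mul_of_nonneg_right h2 (hT₂0 z)]
  rw [integral_add hi₁ hi₂] at key
  refine le_trans ?_ key
  have hsplit : ∫ z, (1 / 2 * (√(p z) * √(q z)) - 1 / 16 * (p z + q z)) ∂μ
      = 1 / 2 * ∫ z, √(p z) * √(q z) ∂μ - 1 / 16 * (1 + 1) := by
    have h := integral_sub (hs.const_mul (1 / 2)) ((hp.add hq).const_mul (1 / 16))
    rw [integral_const_mul, integral_const_mul, integral_add' hp hq, hp1, hq1] at h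
    exact h
  rw [integral_const_mul, hsplit]
  nlinarith

/-- Averaging over the hypercube: if, for each coordinate `j ∈ K`, the error of a sign vector and
of its flip at `j` add up to at least `c`, then some sign vector has total error at least
`|K| c / 2`. -/
lemma exists_sum_ge_of_flip {J : Type*} [Fintype J] [DecidableEq J] (K : Finset J)
    (E : (J → Bool) → J → ℝ) (c : ℝ)
    (h : ∀ σ, ∀ j ∈ K, c ≤ E σ j + E (Function.update σ j (!σ j)) j) :
    ∃ σ, K.card * (c / 2) ≤ ∑ j ∈ K, E σ j := by
  by_contra! hcon
  have h1 : ∑ σ : J → Bool, ∑ j ∈ K, E σ j < ∑ _σ : J → Bool, K.card * (c / 2) :=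
    Finset.sum_lt_sum_of_nonempty Finset.univ_nonempty fun σ _ => hcon σ
  have h2 : ∀ j ∈ K, ∑ _σ : J → Bool, c / 2 ≤ ∑ σ : J → Bool, E σ j := by
    intro j hj
    have hinv : Function.Involutive fun σ : J → Bool => Function.update σ j (!σ j) := by
      intro σ
      simp
    have hflip : ∑ σ : J → Bool, E (Function.update σ j (!σ j)) j = ∑ σ : J → Bool, E σ j :=
      Equiv.sum_comp (hinv.toPerm _) fun σ => E σ j
    have hsum := Finset.sum_le_sum fun σ (_ : σ ∈ Finset.univ) => h σ j hj
    rw [Finset.sum_add_distrib, hflip] at hsum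
    rw [← Finset.sum_div]
    linarith
  have h3 := Finset.sum_le_sum h2
  rw [Finset.sum_comm (s := K), Finset.sum_comm (s := K)] at h3
  simp only [Finset.sum_const, nsmul_eq_mul] at h1 h3
  linarith

/-! ### Regression functions that are constant on cells -/

section StepRegression

variable {X J : Type*}

/-- The regression function that on the cell `j` equals `1 / 2 ± w j`, with sign `+` if and only if
`s j = true`. -/
noncomputable def stepEta (cell : X → J) (w : J → ℝ) (s : J → Bool) (x : X) : ℝ :=
  1 / 2 + if s (cell x) = true then w (cell x) else -w (cell x)

/-- The labels of the cells in the hypercube construction: free on `K`, and `true` elsewhere. -/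
def cubeLabel [DecidableEq J] (K : Finset J) (σ : J → Bool) (j : J) : Bool :=
  if j ∈ K then σ j else true

variable {cell : X → J} {w : J → ℝ} {s : J → Bool}

lemma stepEta_mem_Icc (hw0 : ∀ j, 0 ≤ w j) (hw1 : ∀ j, w j ≤ 1 / 2) (x : X) :
    stepEta cell w s x ∈ Set.Icc (0 : ℝ) 1 := by
  have h0 := hw0 (cell x)
  have h1 := hw1 (cell x)
  unfold stepEta
  split_ifs <;> constructor <;> linarith

lemma half_le_stepEta_iff (hw0 : ∀ j, 0 < w j) (x : X) :
    s (cell x) = true ↔ 1 / 2 ≤ stepEta cell w s x := by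
  have h0 := hw0 (cell x)
  unfold stepEta
  split_ifs with h <;> simp [h, h0, h0.le]

lemma abs_stepEta_sub_half (hw0 : ∀ j, 0 ≤ w j) (x : X) :
    |stepEta cell w s x - 1 / 2| = w (cell x) := by
  have h0 := hw0 (cell x)
  unfold stepEta
  split_ifs <;> simp [abs_of_nonneg h0]

lemma measurable_stepEta [MeasurableSpace X] [MeasurableSpace J] [Countable J]
    [MeasurableSingletonClass J] (hcell : Measurable cell) : Measurable (stepEta cell w s) :=
  (measurable_of_countable fun j => 1 / 2 + if s j = true then w j else -w j).comp hcell

variable [DecidableEq J] {K : Finset J} {σ : J → Bool} {j : J}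

lemma cubeLabel_update_of_ne {i : J} (b : Bool) (h : i ≠ j) :
    cubeLabel K (Function.update σ j b) i = cubeLabel K σ i := by
  simp [cubeLabel, Function.update_of_ne h]

/-- Flipping the label of one cell, with signal `δ` and mass `m`, moves the law of
one observation by a squared Hellinger distance of order at most `δ² m`. -/
lemma one_sub_le_affinity [MeasurableSpace X] [MeasurableSpace J] [Countable J]
    [MeasurableSingletonClass J] {ν : Measure X} [IsProbabilityMeasure ν]
    (hcell : Measurable cell) (hw0 : ∀ j, 0 ≤ w j) (hw1 : ∀ j, w j ≤ 1 / 2) (hj : j ∈ K) :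
    1 - 4 * w j ^ 2 * ν.real (cell ⁻¹' {j})
      ≤ ∫ z, √(labelDensity (stepEta cell w (cubeLabel K σ)) z)
          * √(labelDensity (stepEta cell w (cubeLabel K (Function.update σ j (!σ j)))) z)
          ∂(ν.prod Measure.count) := by
  set η := stepEta cell w (cubeLabel K σ) with hη
  set η' := stepEta cell w (cubeLabel K (Function.update σ j (!σ j))) with hη'
  have hηm : Measurable η := measurable_stepEta hcell
  have hηm' : Measurable η' := measurable_stepEta hcell
  have h01 : ∀ x, η x ∈ Set.Icc (0 : ℝ) 1 := stepEta_mem_Icc hw0 hw1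
  have h01' : ∀ x, η' x ∈ Set.Icc (0 : ℝ) 1 := stepEta_mem_Icc hw0 hw1
  have hFm : Measurable fun z => √(labelDensity η z) * √(labelDensity η' z) :=
    (measurable_labelDensity hηm).sqrt.mul (measurable_labelDensity hηm').sqrt
  have hFi : Integrable (fun z => √(labelDensity η z) * √(labelDensity η' z))
      (ν.prod Measure.count) := by
    refine Integrable.of_bound hFm.aestronglyMeasurable 1 (Filter.Eventually.of_forall fun z => ?_)
    rw [Real.norm_eq_abs, abs_of_nonneg (by positivity)]
    exact mul_le_one₀ (Real.sqrt_le_one.2 (labelDensity_le_one h01 z)) (Real.sqrt_nonneg _)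
      (Real.sqrt_le_one.2 (labelDensity_le_one h01' z))
  have hset : MeasurableSet (cell ⁻¹' {j}) := hcell (measurableSet_singleton j)
  rw [integral_prod _ hFi]
  have hlow : ∫ x, (1 - (cell ⁻¹' {j}).indicator (fun _ => 4 * w j ^ 2) x) ∂ν
      = 1 - 4 * w j ^ 2 * ν.real (cell ⁻¹' {j}) := by
    rw [integral_sub (integrable_const _) ((integrable_const _).indicator hset),
      integral_indicator_const _ hset]
    simp [mul_comm]
  rw [← hlow]
  refine integral_mono ((integrable_const _).sub ((integrable_const _).indicator hset))
    hFi.integral_prod_left fun x => ?_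
  dsimp only
  rw [integral_fintype (by simp)]
  simp only [Fintype.sum_bool, Measure.real, Measure.count_singleton, ENNReal.toReal_one, one_smul,
    labelDensity, if_true, Bool.false_eq_true, if_false]
  by_cases hx : cell x = j
  · have hw : 0 ≤ 1 - 4 * w j ^ 2 := by nlinarith [hw0 j, hw1 j]
    have hw' : 1 - 4 * w j ^ 2 ≤ √(1 - 4 * w j ^ 2) := by
      refine Real.le_sqrt_of_sq_le ?_
      nlinarith [sq_nonneg (w j)]
    have hprod : √(1 / 2 + w j) * √(1 / 2 - w j) = √(1 - 4 * w j ^ 2) / 2 := by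
      rw [← Real.sqrt_mul (by linarith [hw0 j]),
        show (1 / 2 + w j) * (1 / 2 - w j) = (1 - 4 * w j ^ 2) / 2 ^ 2 by ring,
        Real.sqrt_div hw, Real.sqrt_sq (by norm_num)]
    have hx' : x ∈ cell ⁻¹' {j} := hx
    rw [Set.indicator_of_mem hx']
    have e1 : 1 - (1 / 2 + w j) = 1 / 2 - w j := by ring
    have e2 : 1 - (1 / 2 - w j) = 1 / 2 + w j := by ring
    have e3 : 1 / 2 + -w j = 1 / 2 - w j := by ring
    cases hσ : σ j <;>
    · simp only [hη, hη', stepEta, hx, cubeLabel, hj, if_true, Function.update_self, hσ,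
        Bool.not_true, Bool.not_false, Bool.false_eq_true, if_false, e1, e2, e3]
      rw [mul_comm √(1 / 2 - w j), hprod]
      linarith
  · have hxx : η' x = η x := by
      simp only [hη, hη', stepEta, cubeLabel_update_of_ne _ hx]
    have hx' : x ∉ cell ⁻¹' {j} := hx
    rw [Set.indicator_of_notMem hx', hxx, Real.mul_self_sqrt (h01 x).1,
      Real.mul_self_sqrt (by linarith [(h01 x).2])]
    linarith

end StepRegression

/-! ### The risk of a classifier on the hypercube of step regression functions -/

lemma integral_pi_labelledLaw {X : Type*} [MeasurableSpace X] {ν : Measure X}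
    [IsProbabilityMeasure ν] {η : X → ℝ} (hη : Measurable η) (h01 : ∀ x, η x ∈ Set.Icc (0 : ℝ) 1)
    (n : ℕ) (T : (Fin n → X × Bool) → ℝ) :
    ∫ z, T z ∂(Measure.pi fun _ : Fin n => labelledLaw ν η)
      = ∫ z, (∏ i, labelDensity η (z i)) * T z
          ∂(Measure.pi fun _ : Fin n => ν.prod Measure.count) := by
  have hm := measurable_labelDensity hη
  have hi : Integrable (labelDensity η) (ν.prod Measure.count) := by
    refine Integrable.of_bound hm.aestronglyMeasurable 1 (Filter.Eventually.of_forall fun z => ?_)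
    rw [Real.norm_eq_abs, abs_of_nonneg (labelDensity_nonneg h01 z)]
    exact labelDensity_le_one h01 z
  simp only [labelledLaw]
  rw [pi_withDensity_ofReal hi (labelDensity_nonneg h01),
    integral_withDensity_eq_integral_toReal_smul]
  · refine integral_congr_ae (Filter.Eventually.of_forall fun z => ?_)
    simp only [smul_eq_mul]
    rw [ENNReal.toReal_ofReal (Finset.prod_nonneg fun i _ => labelDensity_nonneg h01 _)]
  · exact (Finset.measurable_fun_prod _ fun i _ => hm.comp (measurable_pi_apply i)).ennreal_ofReal
  · simp

/-- The two-point bound for the `n`-fold powers of the laws of two label vectors that differ in one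
cell, when `n` observations cannot detect the signal in that cell. -/
lemma flip_bound {X J : Type*} [MeasurableSpace X] [MeasurableSpace J] [Countable J]
    [MeasurableSingletonClass J] [DecidableEq J] {ν : Measure X} [IsProbabilityMeasure ν]
    {cell : X → J} (hcell : Measurable cell) {w : J → ℝ} (hw0 : ∀ j, 0 ≤ w j)
    (hw1 : ∀ j, w j ≤ 1 / 2) {K : Finset J} {j : J} (hj : j ∈ K) {n : ℕ}
    (hn : n * (4 * w j ^ 2 * ν.real (cell ⁻¹' {j})) ≤ 1 / 2) (σ : J → Bool)
    {T : (Fin n → X × Bool) → Bool → ℝ} {W : ℝ} (hT : ∀ b, Measurable fun z => T z b)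
    (hT0 : ∀ z b, 0 ≤ T z b) (hW : ∀ z, T z true + T z false = W) :
    W / 8 ≤ ∫ z, T z (σ j) ∂(Measure.pi fun _ : Fin n =>
          labelledLaw ν (stepEta cell w (cubeLabel K σ)))
      + ∫ z, T z (!σ j) ∂(Measure.pi fun _ : Fin n =>
          labelledLaw ν (stepEta cell w (cubeLabel K (Function.update σ j (!σ j))))) := by
  have hm : ∀ s, Measurable (stepEta cell w s) := fun s => measurable_stepEta hcell
  have h01 : ∀ s x, stepEta cell w s x ∈ Set.Icc (0 : ℝ) 1 := fun s => stepEta_mem_Icc hw0 hw1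
  have hi : ∀ s, Integrable (labelDensity (stepEta cell w s)) (ν.prod Measure.count) := by
    intro s
    refine Integrable.of_bound (measurable_labelDensity (hm s)).aestronglyMeasurable 1
      (Filter.Eventually.of_forall fun z => ?_)
    rw [Real.norm_eq_abs, abs_of_nonneg (labelDensity_nonneg (h01 s) z)]
    exact labelDensity_le_one (h01 s) z
  have hpi : ∀ s, Integrable
      (fun z : Fin n → X × Bool => ∏ i, labelDensity (stepEta cell w s) (z i))
      (Measure.pi fun _ : Fin n => ν.prod Measure.count) := fun s =>
    Integrable.fintype_prod (f := fun _ => labelDensity (stepEta cell w s)) fun _ => hi s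
  have hp0 : ∀ s (z : Fin n → X × Bool), 0 ≤ ∏ i, labelDensity (stepEta cell w s) (z i) :=
    fun s z => Finset.prod_nonneg fun i _ => labelDensity_nonneg (h01 s) _
  have hp1 : ∀ s, ∫ z, ∏ i, labelDensity (stepEta cell w s) (z i)
      ∂(Measure.pi fun _ : Fin n => ν.prod Measure.count) = 1 := by
    intro s
    have := isProbabilityMeasure_labelledLaw (ν := ν) (hm s) (h01 s)
    have h := integral_pi_labelledLaw (ν := ν) (hm s) (h01 s) n fun _ => 1
    simpa using h.symm
  rw [integral_pi_labelledLaw (hm _) (h01 _), integral_pi_labelledLaw (hm _) (h01 _)]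
  refine two_point_bound (hpi _) (hpi _) (hp0 _) (hp0 _) (hp1 _) (hp1 _) (hT _) (hT _)
    (fun z => hT0 z _) (fun z => hT0 z _) (fun z => ?_) ?_ ?_
  · cases σ j <;> simp [← hW z, add_comm]
  · obtain ⟨z⟩ : Nonempty (Fin n → X × Bool) := by
      have : Nonempty X := ν.nonempty_of_neZero
      infer_instance
    linarith [hW z, hT0 z true, hT0 z false]
  · have haff := one_sub_le_affinity (ν := ν) (σ := σ) hcell hw0 hw1 hj
    have hprod : ∀ z : Fin n → X × Bool,
        √(∏ i, labelDensity (stepEta cell w (cubeLabel K σ)) (z i))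
          * √(∏ i, labelDensity (stepEta cell w (cubeLabel K (Function.update σ j (!σ j)))) (z i))
        = ∏ i, (√(labelDensity (stepEta cell w (cubeLabel K σ)) (z i))
          * √(labelDensity (stepEta cell w (cubeLabel K (Function.update σ j (!σ j)))) (z i))) := by
      intro z
      rw [Real.sqrt_prod _ fun i _ => labelDensity_nonneg (h01 _) _,
        Real.sqrt_prod _ fun i _ => labelDensity_nonneg (h01 _) _, Finset.prod_mul_distrib]
    simp_rw [hprod]
    rw [integral_fintype_prod_eq_pow (fun y =>
      √(labelDensity (stepEta cell w (cubeLabel K σ)) y)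
          * √(labelDensity (stepEta cell w (cubeLabel K (Function.update σ j (!σ j)))) y)),
      Fintype.card_fin]
    have hx0 : 0 ≤ 4 * w j ^ 2 * ν.real (cell ⁻¹' {j}) := by positivity
    have hx1 : 4 * w j ^ 2 * ν.real (cell ⁻¹' {j}) ≤ 1 := by
      have h1 : ν.real (cell ⁻¹' {j}) ≤ 1 := measureReal_le_one
      have h2 : 4 * w j ^ 2 ≤ 1 := by nlinarith [hw0 j, hw1 j]
      exact mul_le_one₀ h2 measureReal_nonneg h1
    refine le_trans ?_ (pow_le_pow_left₀ (by linarith) haff n)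
    have hb := one_add_mul_le_pow (a := -(4 * w j ^ 2 * ν.real (cell ⁻¹' {j}))) (by linarith) n
    rw [← sub_eq_add_neg] at hb
    linarith

/-- Assouad's bound for the excess risk: the signal `wP j` of the source on each cell of `K` is too
small to be detected by `n` observations, while the target signal there is at least `q`. -/
lemma exists_excessRisk_ge {d n : ℕ} {J : Type*} [Fintype J] [MeasurableSpace J]
    [MeasurableSingletonClass J] [DecidableEq J] {ν : Measure (Feature d)} [IsProbabilityMeasure ν]
    {cell : Feature d → J} (hcell : Measurable cell) {wP wQ : J → ℝ}
    (hP0 : ∀ j, 0 ≤ wP j) (hP1 : ∀ j, wP j ≤ 1 / 2) (hQ0 : ∀ j, 0 < wQ j) (hQ1 : ∀ j, wQ j ≤ 1 / 2)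
    {K : Finset J} {q m : ℝ} (hm : ∀ j ∈ K, ν.real (cell ⁻¹' {j}) = m)
    (hq : ∀ j ∈ K, q ≤ wQ j) (hq0 : 0 ≤ q) (hn : ∀ j ∈ K, n * (4 * wP j ^ 2 * m) ≤ 1 / 2)
    (f : Classifier d n) :
    ∃ σ : J → Bool, K.card * (q * m / 8) ≤ excessRisk
      (obsLaw ν (stepEta cell wP (cubeLabel K σ)) (measurable_stepEta hcell)
        (stepEta_mem_Icc hP0 hP1))
      (obsLaw ν (stepEta cell wQ (cubeLabel K σ)) (measurable_stepEta hcell)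
        (stepEta_mem_Icc (fun j => (hQ0 j).le) hQ1)) f := by
  -- The mass of the points of the cell `j` that are not given the label `b`.
  set T : J → (Fin n → Obs d) → Bool → ℝ := fun j z b =>
    ν.real {x | cell x = j ∧ f.1 z x ≠ b} with hTdef
  have hmeasS : ∀ j b, MeasurableSet {p : (Fin n → Obs d) × Feature d |
      cell p.2 = j ∧ f.1 p.1 p.2 ≠ b} := fun j b =>
    ((hcell.comp measurable_snd) (measurableSet_singleton j)).inter
      (f.2 (measurableSet_singleton b)).compl
  have hsec : ∀ j b z, MeasurableSet {x | cell x = j ∧ f.1 z x ≠ b} := fun j b z =>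
    measurable_prodMk_left (hmeasS j b)
  have hTm : ∀ j b, Measurable fun z => T j z b := fun j b =>
    (measurable_measure_prodMk_left (hmeasS j b)).ennreal_toReal
  have hT0 : ∀ j z b, 0 ≤ T j z b := fun j z b => measureReal_nonneg
  have hT1 : ∀ j z b, T j z b ≤ 1 := fun j z b => measureReal_le_one
  have hTW : ∀ j ∈ K, ∀ z, T j z true + T j z false = m := by
    intro j hj z
    rw [hTdef, ← hm j hj, ← measureReal_union _ (hsec j false z)]
    · congr 1
      ext x
      cases h : f.1 z x <;> simp [h]
    · rw [Set.disjoint_left]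
      rintro x ⟨-, h1⟩ ⟨-, h2⟩
      cases h : f.1 z x <;> simp_all
  have hmP : ∀ σ, Measurable (stepEta cell wP (cubeLabel K σ)) := fun σ => measurable_stepEta hcell
  have hPI : ∀ σ x, stepEta cell wP (cubeLabel K σ) x ∈ Set.Icc (0 : ℝ) 1 := fun σ =>
    stepEta_mem_Icc hP0 hP1
  have hmQ : ∀ σ, Measurable (stepEta cell wQ (cubeLabel K σ)) := fun σ => measurable_stepEta hcell
  have hQI : ∀ σ x, stepEta cell wQ (cubeLabel K σ) x ∈ Set.Icc (0 : ℝ) 1 := fun σ =>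
    stepEta_mem_Icc (fun j => (hQ0 j).le) hQ1
  obtain ⟨σ, hσ⟩ := exists_sum_ge_of_flip K (fun σ j => ∫ z, T j z (σ j) ∂(Measure.pi
    fun _ : Fin n => labelledLaw ν (stepEta cell wP (cubeLabel K σ)))) (m / 8) (by
      intro σ j hj
      have := flip_bound (ν := ν) hcell hP0 hP1 hj (n := n) (by rw [hm j hj]; exact hn j hj) σ
        (hTm j) (hT0 j) (hTW j hj)
      simpa only [Function.update_self] using this)
  refine ⟨σ, ?_⟩
  have hprob := isProbabilityMeasure_labelledLaw (ν := ν) (hmP σ) (hPI σ)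
  have hTi : ∀ j, Integrable (fun z => T j z (σ j)) (Measure.pi
      fun _ : Fin n => labelledLaw ν (stepEta cell wP (cubeLabel K σ))) := fun j =>
    Integrable.of_bound (hTm j _).aestronglyMeasurable 1 (Filter.Eventually.of_forall fun z => by
      rw [Real.norm_eq_abs, abs_of_nonneg (hT0 j z _)]; exact hT1 j z _)
  have hfz : ∀ z, Measurable (f.1 z) := fun z => f.2.comp measurable_prodMk_left
  have hg : Measurable fun x => cubeLabel K σ (cell x) :=
    (measurable_of_countable (cubeLabel K σ)).comp hcell
  -- Excess risk of a fixed classifier: only the cells of `K` are kept.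
  have hlow : ∀ z, ∑ j ∈ K, 2 * q * T j z (σ j) ≤
      classRisk (obsLaw ν (stepEta cell wQ (cubeLabel K σ)) (hmQ σ) (hQI σ)) (f.1 z)
        - classRisk (obsLaw ν (stepEta cell wQ (cubeLabel K σ)) (hmQ σ) (hQI σ))
            (bayesClassifier (obsLaw ν (stepEta cell wQ (cubeLabel K σ)) (hmQ σ) (hQI σ))) := by
    intro z
    rw [classRisk_sub_bayes_obsLaw (hmQ σ) (hQI σ) (hfz z) hg (half_le_stepEta_iff hQ0)]
    have hind : ∀ j, ∫ x, {x | cell x = j ∧ f.1 z x ≠ σ j}.indicator (fun _ => 2 * q) x ∂ν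
        = 2 * q * T j z (σ j) := by
      intro j
      rw [integral_indicator_const _ (hsec j _ z), smul_eq_mul, mul_comm]
    simp_rw [← hind]
    rw [← integral_finsetSum _ fun j _ => (integrable_const _).indicator (hsec j _ z)]
    refine integral_mono (integrable_finsetSum _ fun j _ =>
      (integrable_const _).indicator (hsec j _ z)) ?_ fun x => ?_
    · refine Integrable.of_bound (Measurable.ite (measurableSet_eq_fun (hfz z) hg)
        measurable_const ((measurable_const.mul (hmQ σ)).sub measurable_const).abs
        ).aestronglyMeasurable 1
        (Filter.Eventually.of_forall fun x => ?_)
      have := hQI σ x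
      split_ifs
      · simp
      · rw [Real.norm_eq_abs, abs_abs, abs_le]
        constructor <;> linarith [this.1, this.2]
    · dsimp only
      have hw : |2 * stepEta cell wQ (cubeLabel K σ) x - 1| = 2 * wQ (cell x) := by
        rw [show 2 * stepEta cell wQ (cubeLabel K σ) x - 1
          = 2 * (stepEta cell wQ (cubeLabel K σ) x - 1 / 2) by ring, abs_mul,
          abs_stepEta_sub_half fun j => (hQ0 j).le]
        simp
      rw [hw]
      by_cases hK : cell x ∈ K
      · rw [Finset.sum_eq_single_of_mem _ hK fun j _ hj => Set.indicator_of_notMem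
          (fun h => hj h.1.symm) _]
        simp only [Set.indicator, Set.mem_ofPred_eq, true_and, cubeLabel, hK, if_true, ne_eq]
        by_cases hfx : f.1 z x = σ (cell x)
        · simp [hfx]
        · simpa [hfx] using hq _ hK
      · have hnot : ∀ j ∈ K, x ∉ {x | cell x = j ∧ f.1 z x ≠ σ j} := fun j hj h => hK (h.1 ▸ hj)
        rw [Finset.sum_eq_zero fun j hj => Set.indicator_of_notMem (hnot j hj) _]
        split_ifs
        · exact le_rfl
        · linarith [hQ0 (cell x)]
  have hriskm : Measurable fun z =>
      classRisk (obsLaw ν (stepEta cell wQ (cubeLabel K σ)) (hmQ σ) (hQI σ)) (f.1 z) := by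
    refine (measurable_measure_prodMk_left (ν := ((obsLaw ν (stepEta cell wQ (cubeLabel K σ))
      (hmQ σ) (hQI σ) : ProbabilityMeasure (Obs d)) : Measure (Obs d)))
      (s := {p : (Fin n → Obs d) × Obs d | f.1 p.1 p.2.1 ≠ p.2.2}) ?_).ennreal_toReal
    exact (measurableSet_eq_fun (f.2.comp (measurable_fst.prodMk
      (measurable_fst.comp measurable_snd))) (measurable_snd.comp measurable_snd)).compl
  have hriski : Integrable (fun z =>
      classRisk (obsLaw ν (stepEta cell wQ (cubeLabel K σ)) (hmQ σ) (hQI σ)) (f.1 z))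
      (Measure.pi fun _ : Fin n => labelledLaw ν (stepEta cell wP (cubeLabel K σ))) :=
    Integrable.of_bound hriskm.aestronglyMeasurable 1 (Filter.Eventually.of_forall fun z => by
      rw [Real.norm_eq_abs, classRisk, abs_of_nonneg measureReal_nonneg]
      exact measureReal_le_one)
  set R := classRisk (obsLaw ν (stepEta cell wQ (cubeLabel K σ)) (hmQ σ) (hQI σ))
    (bayesClassifier (obsLaw ν (stepEta cell wQ (cubeLabel K σ)) (hmQ σ) (hQI σ))) with hR
  have hmono := integral_mono (μ := Measure.pi
      fun _ : Fin n => labelledLaw ν (stepEta cell wP (cubeLabel K σ)))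
    (integrable_finsetSum K fun j _ => (hTi j).const_mul (2 * q))
    (hriski.sub (integrable_const R)) hlow
  rw [integral_finsetSum _ fun j _ => (hTi j).const_mul _,
    integral_sub' hriski (integrable_const R)] at hmono
  simp_rw [integral_const_mul] at hmono
  rw [← Finset.mul_sum, integral_const, probReal_univ, one_smul] at hmono
  refine le_trans ?_ hmono
  nlinarith [mul_le_mul_of_nonneg_left hσ (show 0 ≤ 2 * q by linarith)]

/-! ### The perforated cube -/

/-- The middle half of the `k`-th of the `N` equal subintervals of `[0,1]`. -/
def coreInterval (N k : ℕ) : Set ℝ := Set.Icc (((k : ℝ) + 1 / 4) / N) (((k : ℝ) + 3 / 4) / N)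

/-- The union of the middle halves of the `N` equal subintervals of `[0,1]`. -/
def coreSet (N : ℕ) : Set ℝ := ⋃ k : Fin N, coreInterval N k

/-- The perforated cube `coreSet N ^ d`: one core cube of side `1 / (2N)` in the middle of each of
the `N ^ d` cells of the regular grid on `[0,1]^d`. -/
def coreCubes (N d : ℕ) : Set (Feature d) := {x | ∀ i, x i ∈ coreSet N}

/-- The index of the grid cell containing a point of `[0,1)^d`. Outside of `[0,1)^d` the value is
irrelevant: it is some index, by reduction modulo `N`. -/
noncomputable def gridCell (N : ℕ) [NeZero N] {d : ℕ} (x : Feature d) (i : Fin d) : Fin N :=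
  Fin.ofNat N ⌊(N : ℝ) * x i⌋₊

lemma mem_coreInterval {N k : ℕ} [NeZero N] {t : ℝ} :
    t ∈ coreInterval N k ↔ (k : ℝ) + 1 / 4 ≤ N * t ∧ N * t ≤ k + 3 / 4 := by
  have hN : (0 : ℝ) < N := by exact_mod_cast Nat.pos_of_neZero N
  rw [coreInterval, Set.mem_Icc, div_le_iff₀' hN, le_div_iff₀' hN]

lemma mem_coreSet {N : ℕ} {t : ℝ} : t ∈ coreSet N ↔ ∃ k : Fin N, t ∈ coreInterval N k :=
  Set.mem_iUnion

lemma coreInterval_subset_coreSet {N k : ℕ} (hk : k < N) : coreInterval N k ⊆ coreSet N :=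
  fun _ ht => mem_coreSet.2 ⟨⟨k, hk⟩, ht⟩

lemma floor_of_mem_coreInterval {N k : ℕ} [NeZero N] {t : ℝ} (ht : t ∈ coreInterval N k) :
    ⌊(N : ℝ) * t⌋₊ = k := by
  rw [mem_coreInterval] at ht
  rw [Nat.floor_eq_iff (by linarith [ht.1, (Nat.cast_nonneg k : (0 : ℝ) ≤ k)])]
  constructor <;> linarith [ht.1, ht.2]

lemma coreSet_subset_Icc (N : ℕ) [NeZero N] : coreSet N ⊆ Set.Icc 0 1 := by
  intro t ht
  obtain ⟨k, hk⟩ := mem_coreSet.1 ht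
  rw [mem_coreInterval] at hk
  have hN : (0 : ℝ) < N := by exact_mod_cast Nat.pos_of_neZero N
  have h1 : ((k : ℕ) : ℝ) + 1 ≤ N := by exact_mod_cast k.2
  have h0 : (0 : ℝ) ≤ ((k : ℕ) : ℝ) := Nat.cast_nonneg _
  constructor <;> nlinarith [hk.1, hk.2]

lemma isClosed_coreSet (N : ℕ) : IsClosed (coreSet N) :=
  isClosed_iUnion_of_finite fun _ => isClosed_Icc

lemma isClosed_coreCubes (N d : ℕ) : IsClosed (coreCubes N d) := by
  have : coreCubes N d = ⋂ i : Fin d, (fun x : Feature d => x i) ⁻¹' coreSet N := by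
    ext x
    simp [coreCubes]
  rw [this]
  exact isClosed_iInter fun i => (isClosed_coreSet N).preimage (by fun_prop)

lemma coreCubes_subset_unitCube (N d : ℕ) [NeZero N] : coreCubes N d ⊆ unitCube d :=
  fun _ hx i => coreSet_subset_Icc N (hx i)

lemma measurable_gridCell (N d : ℕ) [NeZero N] :
    Measurable (gridCell N : Feature d → Fin d → Fin N) := by
  refine measurable_pi_lambda _ fun i => ?_
  exact (measurable_of_countable (Fin.ofNat N)).comp
    (Nat.measurable_floor.comp (by fun_prop))

lemma apply_mem_coreInterval_gridCell {N d : ℕ} [NeZero N] {x : Feature d}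
    (hx : x ∈ coreCubes N d) (i : Fin d) : x i ∈ coreInterval N (gridCell N x i) := by
  obtain ⟨k, hk⟩ := mem_coreSet.1 (hx i)
  have : gridCell N x i = k := by
    rw [gridCell, floor_of_mem_coreInterval hk, Fin.ofNat_val_eq_self]
  rwa [this]

lemma coreCubes_inter_gridCell {N d : ℕ} [NeZero N] (j : Fin d → Fin N) :
    coreCubes N d ∩ gridCell N ⁻¹' {j} = {x | ∀ i, x i ∈ coreInterval N (j i)} := by
  ext x
  constructor
  · rintro ⟨hx, rfl⟩ i
    exact apply_mem_coreInterval_gridCell hx i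
  · intro hx
    refine ⟨fun i => coreInterval_subset_coreSet (j i).2 (hx i), funext fun i => ?_⟩
    rw [gridCell, floor_of_mem_coreInterval (hx i), Fin.ofNat_val_eq_self]

/-- The cell index is `2`-Lipschitz on the perforated cube, in units of the mesh: distinct cells
are separated by gaps of half a mesh. -/
lemma abs_gridCell_sub_le {N d : ℕ} [NeZero N] {x y : Feature d} (hx : x ∈ coreCubes N d)
    (hy : y ∈ coreCubes N d) (i : Fin d) :
    |((gridCell N x i : ℕ) : ℝ) - (gridCell N y i : ℕ)| ≤ 2 * N * ‖x - y‖ := by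
  have hN : (0 : ℝ) < N := by exact_mod_cast Nat.pos_of_neZero N
  have h1 := mem_coreInterval.1 (apply_mem_coreInterval_gridCell hx i)
  have h2 := mem_coreInterval.1 (apply_mem_coreInterval_gridCell hy i)
  have h3 : |x i - y i| ≤ ‖x - y‖ := by simpa using PiLp.norm_apply_le (x - y) i
  have h4 := abs_le.1 h3
  have key : ∀ {a b : ℕ}, ∀ {u v : ℝ}, (a : ℝ) + 1 / 4 ≤ N * u ∧ N * u ≤ a + 3 / 4 →
      (b : ℝ) + 1 / 4 ≤ N * v ∧ N * v ≤ b + 3 / 4 → u - v ≤ ‖x - y‖ →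
      (a : ℝ) - b ≤ 2 * N * ‖x - y‖ := by
    intro a b u v hu hv huv
    rcases le_or_gt a b with hab | hab
    · have : (a : ℝ) ≤ b := by exact_mod_cast hab
      have : 0 ≤ 2 * N * ‖x - y‖ := by positivity
      linarith
    · have : (b : ℝ) + 1 ≤ a := by exact_mod_cast hab
      nlinarith [mul_le_mul_of_nonneg_left huv hN.le]
  rw [abs_le]
  constructor
  · linarith [key h2 h1 (by linarith [h4.1])]
  · exact key h1 h2 h4.2

lemma volume_coreInterval (N k : ℕ) :
    volume (coreInterval N k) = ENNReal.ofReal (1 / (2 * N)) := by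
  rw [coreInterval, Real.volume_Icc]
  congr 1
  rcases eq_or_ne (N : ℝ) 0 with h | h
  · simp [h]
  · field_simp
    ring

lemma volume_feature_box {d : ℕ} (s : Fin d → Set ℝ) :
    volume {x : Feature d | ∀ i, x i ∈ s i} = ∏ i, volume (s i) := by
  rw [← volume_pi_pi, ← (EuclideanSpace.volume_preserving_symm_measurableEquiv_toLp (Fin d)
    ).measure_preimage_equiv]
  congr 1
  ext x
  simp

/-! ### Regularity of the perforated cube -/

lemma volume_biUnion_coreInterval (N : ℕ) [NeZero N] (s : Finset ℕ) :
    volume (⋃ k ∈ s, coreInterval N k) = s.card * ENNReal.ofReal (1 / (2 * N)) := by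
  rw [measure_biUnion_finset]
  · simp [volume_coreInterval]
  · intro a _ b _ hab
    refine Set.disjoint_left.2 fun t ha hb => hab ?_
    rw [← floor_of_mem_coreInterval ha, floor_of_mem_coreInterval hb]
  · exact fun _ _ => measurableSet_Icc

lemma volume_coreSet_inter_Ioo {N : ℕ} [NeZero N] {t ρ : ℝ} (ht : t ∈ coreSet N) (hρ : 0 < ρ)
    (hρ1 : ρ ≤ 1) :
    ENNReal.ofReal (ρ / 4) ≤ volume (coreSet N ∩ Set.Ioo (t - ρ) (t + ρ)) := by
  have hN : (0 : ℝ) < N := by exact_mod_cast Nat.pos_of_neZero N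
  obtain ⟨k, hk⟩ := mem_coreSet.1 ht
  have hk' := mem_coreInterval.1 hk
  rcases le_or_gt (N * ρ) 1 with hsmall | hlarge
  · -- Small scales: half of the core interval of `t` lies on one side of `t`.
    rcases le_total (N * t) ((k : ℕ) + 1 / 2) with hleft | hright
    · calc ENNReal.ofReal (ρ / 4) = volume (Set.Ico t (t + ρ / 4)) := by
            rw [Real.volume_Ico]; congr 1; ring
        _ ≤ _ := by
            refine measure_mono fun y hy => ⟨coreInterval_subset_coreSet k.2
              (mem_coreInterval.2 ⟨?_, ?_⟩), ?_, ?_⟩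
            · nlinarith [hy.1, hy.2]
            · nlinarith [hy.1, hy.2]
            · linarith [hy.1]
            · linarith [hy.2]
    · calc ENNReal.ofReal (ρ / 4) = volume (Set.Ioc (t - ρ / 4) t) := by
            rw [Real.volume_Ioc]; congr 1; ring
        _ ≤ _ := by
            refine measure_mono fun y hy => ⟨coreInterval_subset_coreSet k.2
              (mem_coreInterval.2 ⟨?_, ?_⟩), ?_, ?_⟩
            · nlinarith [hy.1, hy.2]
            · nlinarith [hy.1, hy.2]
            · linarith [hy.1]
            · linarith [hy.2]
  · -- Large scales: `⌊N ρ⌋` consecutive cells, among them that of `t`.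
    set m := ⌊(N : ℝ) * ρ⌋₊ with hm
    have hm1 : 1 ≤ m := Nat.le_floor (by simpa using hlarge.le)
    have hmρ : (m : ℝ) ≤ N * ρ := Nat.floor_le (by positivity)
    have hρm : N * ρ < m + 1 := Nat.lt_floor_add_one _
    have hmN : m ≤ N := by
      have : (m : ℝ) ≤ N := by nlinarith
      exact_mod_cast this
    set s := (k : ℕ) + 1 - m with hs
    have hsk : s ≤ k := by omega
    have hks : (k : ℕ) + 1 ≤ s + m := by omega
    have hsN : s + m ≤ N := by have := k.2; omega
    have hskR : (s : ℝ) ≤ (k : ℕ) := by exact_mod_cast hsk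
    have hksR : ((k : ℕ) : ℝ) + 1 ≤ s + m := by exact_mod_cast hks
    calc ENNReal.ofReal (ρ / 4) ≤ ENNReal.ofReal (m * (1 / (2 * N))) := by
          refine ENNReal.ofReal_le_ofReal ?_
          have : (1 : ℝ) ≤ m := by exact_mod_cast hm1
          rw [mul_one_div, le_div_iff₀ (by positivity)]
          nlinarith
      _ = volume (⋃ l ∈ Finset.Ico s (s + m), coreInterval N l) := by
          rw [volume_biUnion_coreInterval, Nat.card_Ico, ENNReal.ofReal_mul (by positivity),
            ENNReal.ofReal_natCast]
          simp
      _ ≤ _ := by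
          refine measure_mono fun y hy => ?_
          simp only [Set.mem_iUnion, Finset.mem_Ico, exists_prop] at hy
          obtain ⟨l, ⟨hl1, hl2⟩, hyl⟩ := hy
          have hl1R : (s : ℝ) ≤ l := by exact_mod_cast hl1
          have hl2R : (l : ℝ) + 1 ≤ s + m := by exact_mod_cast hl2
          have hyl' := mem_coreInterval.1 hyl
          refine ⟨coreInterval_subset_coreSet (by omega) hyl, ?_, ?_⟩ <;>
          · refine lt_of_mul_lt_mul_left ?_ hN.le
            linarith [hyl'.1, hyl'.2, hk'.1, hk'.2]

lemma volume_ball_le {d : ℕ} (x : Feature d) {r : ℝ} (hr : 0 < r) :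
    volume (Metric.ball x r) ≤ ENNReal.ofReal ((2 * r) ^ d) := by
  calc volume (Metric.ball x r)
      ≤ volume {y : Feature d | ∀ i, y i ∈ Set.Ioo (x i - r) (x i + r)} := by
        refine measure_mono fun y hy i => ?_
        rw [mem_ball_iff_norm] at hy
        have h : |y i - x i| ≤ ‖y - x‖ := by simpa using PiLp.norm_apply_le (y - x) i
        have := abs_lt.1 (h.trans_lt hy)
        constructor <;> linarith [this.1, this.2]
    _ = _ := by
        rw [volume_feature_box]
        have h : ∀ i, volume (Set.Ioo (x i - r) (x i + r)) = ENNReal.ofReal (2 * r) := fun i => by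
          rw [Real.volume_Ioo]; congr 1; ring
        simp only [h, Finset.prod_const, Finset.card_univ, Fintype.card_fin]
        rw [ENNReal.ofReal_pow (by positivity)]

/-- The constant of the regularity condition of the perforated cube, at the scales below `r₀`. -/
noncomputable def regularityConst (d : ℕ) (r₀ : ℝ) : ℝ :=
  (min (1 / (2 * (d : ℝ))) (1 / r₀) / 8) ^ d

lemma regularityConst_pos {d : ℕ} (hd : 1 ≤ d) {r₀ : ℝ} (hr₀ : 0 < r₀) :
    0 < regularityConst d r₀ := by
  have : (0 : ℝ) < d := by exact_mod_cast hd
  unfold regularityConst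
  positivity

/-- The perforated cube is regular, uniformly in the mesh of the grid. -/
lemma coreCubes_regular {N d : ℕ} [NeZero N] (hd : 1 ≤ d) {r₀ c : ℝ} (hr₀ : 0 < r₀)
    (hc : c ≤ regularityConst d r₀) {x : Feature d} (hx : x ∈ coreCubes N d) {r : ℝ} (hr : 0 < r)
    (hrr : r < r₀) :
    ENNReal.ofReal c * volume (Metric.ball x r) ≤ volume (coreCubes N d ∩ Metric.ball x r) := by
  have hdR : (1 : ℝ) ≤ d := by exact_mod_cast hd
  set κ : ℝ := min (1 / (2 * (d : ℝ))) (1 / r₀) with hκ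
  have hκ0 : 0 < κ := by positivity
  have hκd : κ * (2 * d) ≤ 1 := by
    rw [← le_div_iff₀ (by positivity)]; exact min_le_left _ _
  have hκr : κ * r₀ ≤ 1 := by
    rw [← le_div_iff₀ hr₀]; exact min_le_right _ _
  have hρ0 : 0 < κ * r := by positivity
  have hρ1 : κ * r ≤ 1 := by nlinarith
  calc ENNReal.ofReal c * volume (Metric.ball x r)
      ≤ ENNReal.ofReal ((κ / 8) ^ d) * ENNReal.ofReal ((2 * r) ^ d) := by
        gcongr
        · exact hc
        · exact volume_ball_le x hr
    _ = ∏ _i : Fin d, ENNReal.ofReal (κ * r / 4) := by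
        rw [← ENNReal.ofReal_mul (by positivity), ← mul_pow, Finset.prod_const, Finset.card_univ,
          Fintype.card_fin, ← ENNReal.ofReal_pow (by positivity)]
        congr 2
        ring
    _ ≤ ∏ i, volume (coreSet N ∩ Set.Ioo (x i - κ * r) (x i + κ * r)) := by
        gcongr with i
        exact volume_coreSet_inter_Ioo (hx i) hρ0 hρ1
    _ = volume {y : Feature d | ∀ i, y i ∈ coreSet N ∩ Set.Ioo (x i - κ * r) (x i + κ * r)} :=
        (volume_feature_box _).symm
    _ ≤ _ := by
        refine measure_mono fun y hy => ⟨fun i => (hy i).1, ?_⟩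
        rw [Metric.mem_ball, EuclideanSpace.dist_eq, Real.sqrt_lt' hr]
        have h : ∀ i, dist (y i) (x i) ^ 2 ≤ (κ * r) ^ 2 := by
          intro i
          rw [Real.dist_eq]
          refine pow_le_pow_left₀ (abs_nonneg _) (abs_le.2 ?_) 2
          have := (hy i).2
          constructor <;> linarith [this.1, this.2]
        have hsum := Finset.sum_le_sum fun i (_ : i ∈ Finset.univ) => h i
        rw [Finset.sum_const, Finset.card_univ, Fintype.card_fin, nsmul_eq_mul] at hsum
        refine hsum.trans_lt ?_
        have h1 : d * κ ^ 2 < 1 := by nlinarith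
        calc d * (κ * r) ^ 2 = (d * κ ^ 2) * r ^ 2 := by ring
          _ < 1 * r ^ 2 := by gcongr
          _ = r ^ 2 := one_mul _

/-! ### The uniform distribution on the perforated cube -/

/-- The uniform distribution on the perforated cube, which has volume `2⁻ᵈ`. -/
noncomputable def uniformCore (N d : ℕ) : Measure (Feature d) :=
  volume.withDensity fun x => ENNReal.ofReal ((coreCubes N d).indicator (fun _ => (2 : ℝ) ^ d) x)

lemma uniformCore_apply (N d : ℕ) {s : Set (Feature d)} (hs : MeasurableSet s) :
    uniformCore N d s = ENNReal.ofReal (2 ^ d) * volume (coreCubes N d ∩ s) := by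
  have hΩ := (isClosed_coreCubes N d).measurableSet
  have h : (fun x => ENNReal.ofReal ((coreCubes N d).indicator (fun _ => (2 : ℝ) ^ d) x))
      = (coreCubes N d).indicator fun _ => ENNReal.ofReal (2 ^ d) := by
    ext x
    by_cases hx : x ∈ coreCubes N d <;> simp [hx]
  rw [uniformCore, withDensity_apply _ hs, h, lintegral_indicator hΩ, lintegral_const,
    Measure.restrict_restrict hΩ, Measure.restrict_apply_univ]

lemma uniformCore_gridCell (N d : ℕ) [NeZero N] (j : Fin d → Fin N) :
    uniformCore N d (gridCell N ⁻¹' {j}) = ENNReal.ofReal ((1 / N) ^ d) := by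
  rw [uniformCore_apply _ _ (measurable_gridCell N d (measurableSet_singleton j)),
    coreCubes_inter_gridCell, volume_feature_box]
  simp only [volume_coreInterval, Finset.prod_const, Finset.card_univ, Fintype.card_fin]
  rw [← ENNReal.ofReal_pow (by positivity), ← ENNReal.ofReal_mul (by positivity), ← mul_pow]
  congr 2
  ring

lemma isProbabilityMeasure_uniformCore (N d : ℕ) [NeZero N] :
    IsProbabilityMeasure (uniformCore N d) := by
  have hN : (N : ℝ) ≠ 0 := by exact_mod_cast NeZero.ne N
  constructor
  have h := sum_measure_preimage_singleton (μ := uniformCore N d)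
    (Finset.univ : Finset (Fin d → Fin N)) (f := gridCell N) fun j _ =>
      measurable_gridCell N d (measurableSet_singleton j)
  simp only [Finset.coe_univ, Set.preimage_univ] at h
  rw [← h]
  simp only [uniformCore_gridCell, Finset.sum_const, Finset.card_univ, Fintype.card_pi,
    Fintype.card_fin, Finset.prod_const, nsmul_eq_mul]
  rw [← ENNReal.ofReal_natCast, ← ENNReal.ofReal_mul (by positivity)]
  push_cast
  rw [← mul_pow, mul_one_div_cancel hN]
  simp

lemma uniformCore_real_gridCell (N d : ℕ) [NeZero N] (A : Finset (Fin d → Fin N)) :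
    (uniformCore N d).real (gridCell N ⁻¹' A) = A.card * (1 / N) ^ d := by
  have hP := isProbabilityMeasure_uniformCore N d
  rw [Measure.real, ← sum_measure_preimage_singleton A fun j _ =>
    measurable_gridCell N d (measurableSet_singleton j)]
  simp only [uniformCore_gridCell, Finset.sum_const, nsmul_eq_mul]
  rw [ENNReal.toReal_mul, ENNReal.toReal_ofReal (by positivity), ENNReal.toReal_natCast]

lemma ae_mem_coreCubes (N d : ℕ) : coreCubes N d ∈ ae (uniformCore N d) := by
  rw [mem_ae_iff, uniformCore_apply _ _ (isClosed_coreCubes N d).measurableSet.compl]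
  simp

lemma support_uniformCore {N d : ℕ} [NeZero N] (hd : 1 ≤ d) :
    (uniformCore N d).support = coreCubes N d := by
  refine subset_antisymm
    (Measure.support_subset_of_isClosed (isClosed_coreCubes N d) (ae_mem_coreCubes N d)) ?_
  intro x hx
  rw [Metric.nhds_basis_ball.mem_measureSupport]
  intro r hr
  rw [uniformCore_apply _ _ Metric.isOpen_ball.measurableSet]
  refine ENNReal.mul_pos (by simp) (ne_of_gt ?_)
  have hr2 : 0 < r / 2 := by linarith
  calc 0 < ENNReal.ofReal (regularityConst d r) * volume (Metric.ball x (r / 2)) :=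
        ENNReal.mul_pos (by simpa using regularityConst_pos hd hr)
          (Metric.measure_ball_pos _ _ hr2).ne'
    _ ≤ volume (coreCubes N d ∩ Metric.ball x (r / 2)) :=
        coreCubes_regular hd hr le_rfl hx hr2 (by linarith)
    _ ≤ _ := measure_mono (Set.inter_subset_inter_right _ (Metric.ball_subset_ball (by linarith)))

lemma hasDensityBounds_uniformCore {N d : ℕ} (hd : 1 ≤ d) {c : ℝ} (hc0 : 0 < c)
    (hc : c ≤ (1 / 4) ^ d) : HasDensityBounds (uniformCore N d) (coreCubes N d) c := by
  refine ⟨_, measurable_const.indicator (isClosed_coreCubes N d).measurableSet, rfl,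
    fun x hx => ?_⟩
  rw [Set.indicator_of_mem hx]
  have hd0 : d ≠ 0 := by omega
  constructor
  · calc c ≤ (1 / 4) ^ d := hc
      _ < 2 ^ d := by gcongr; norm_num
  · calc (2 : ℝ) ^ d < 4 ^ d := by gcongr; norm_num
      _ = ((1 / 4) ^ d)⁻¹ := by rw [one_div, inv_pow, inv_inv]
      _ ≤ c⁻¹ := by gcongr

/-! ### The signal levels -/

section Level

variable {N d : ℕ}

/-- The cells of the corner block `[0, M / N)^d`, whose labels are free. -/
def blockCells (N d M : ℕ) : Finset (Fin d → Fin N) :=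
  Fintype.piFinset fun _ => Finset.univ.filter fun k : Fin N => (k : ℕ) < M

/-- The sup-distance of a cell to the corner block, in units of the mesh, truncated below at `1`. -/
def cellLevel (M : ℕ) (j : Fin d → Fin N) : ℕ :=
  max 1 ((Finset.univ.sup fun i => (j i : ℕ)) + 1 - M)

/-- The signal `a * h ^ e` of a cell, where `h ∈ (0,1]` is the level of the cell times the mesh. -/
noncomputable def cellSignal (M : ℕ) (a e : ℝ) (j : Fin d → Fin N) : ℝ :=
  a * ((cellLevel M j : ℝ) / N) ^ e

variable {M : ℕ} {j k : Fin d → Fin N}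

lemma mem_blockCells : j ∈ blockCells N d M ↔ ∀ i, (j i : ℕ) < M := by
  simp [blockCells, Fintype.mem_piFinset]

lemma card_blockCells (hM : M ≤ N) : (blockCells N d M).card = M ^ d := by
  rw [blockCells, Fintype.card_piFinset_const, Fin.card_filter_val_lt, min_eq_right hM]

lemma one_le_cellLevel : 1 ≤ cellLevel M j := le_max_left _ _

lemma apply_add_one_le_cellLevel (i : Fin d) : (j i : ℕ) + 1 ≤ cellLevel M j + M := by
  have h : (j i : ℕ) ≤ Finset.univ.sup fun i => (j i : ℕ) :=
    Finset.le_sup (f := fun i => (j i : ℕ)) (Finset.mem_univ i)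
  unfold cellLevel
  omega

lemma cellLevel_eq (M : ℕ) (j : Fin d → Fin N) :
    cellLevel M j = 1 ∨ ∃ i, cellLevel M j + M = (j i : ℕ) + 1 := by
  by_cases h : (Finset.univ.sup fun i => (j i : ℕ)) + 1 - M ≤ 1
  · left
    exact max_eq_left h
  · right
    rcases (Finset.univ : Finset (Fin d)).eq_empty_or_nonempty with he | hne
    · rw [he, Finset.sup_empty, bot_eq_zero] at h
      omega
    · obtain ⟨i, -, hi⟩ := Finset.exists_mem_eq_sup _ hne fun i => (j i : ℕ)
      refine ⟨i, ?_⟩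
      unfold cellLevel
      omega

lemma cellLevel_of_mem_blockCells (hj : j ∈ blockCells N d M) : cellLevel M j = 1 := by
  rw [mem_blockCells] at hj
  rcases cellLevel_eq M j with h | ⟨i, hi⟩
  · exact h
  · have := hj i
    have := one_le_cellLevel (M := M) (j := j)
    omega

lemma cellLevel_le [NeZero N] : cellLevel M j ≤ N := by
  have := Nat.pos_of_neZero N
  rcases cellLevel_eq M j with h | ⟨i, hi⟩
  · omega
  · have := (j i).2
    omega

lemma cellLevel_div_pos [NeZero N] : 0 < (cellLevel M j : ℝ) / N := by
  have h1 : (0 : ℝ) < cellLevel M j := by exact_mod_cast one_le_cellLevel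
  have h2 : (0 : ℝ) < N := by exact_mod_cast Nat.pos_of_neZero N
  positivity

lemma cellLevel_div_le_one [NeZero N] : (cellLevel M j : ℝ) / N ≤ 1 := by
  have h2 : (0 : ℝ) < N := by exact_mod_cast Nat.pos_of_neZero N
  rw [div_le_one h2]
  exact_mod_cast cellLevel_le

lemma cellLevel_le_add {D : ℝ} (hD0 : 0 ≤ D) (hD : ∀ i, |((j i : ℕ) : ℝ) - (k i : ℕ)| ≤ D) :
    (cellLevel M j : ℝ) ≤ cellLevel M k + D := by
  rcases cellLevel_eq M j with h | ⟨i, hi⟩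
  · have : (1 : ℝ) ≤ cellLevel M k := by exact_mod_cast one_le_cellLevel
    rw [h]
    push_cast
    linarith
  · have h1 : (cellLevel M j : ℝ) + M = (j i : ℕ) + 1 := by exact_mod_cast hi
    have h2 : ((k i : ℕ) : ℝ) + 1 ≤ cellLevel M k + M := by
      exact_mod_cast apply_add_one_le_cellLevel i
    linarith [(abs_le.1 (hD i)).2]

/-- The levels of a cell of the block and of another cell add up to at most twice their distance,
so that the signed level remains Lipschitz whatever the signs. -/
lemma cellLevel_add_le_of_mem_blockCells {D : ℝ} (hj : j ∈ blockCells N d M) (hjk : j ≠ k)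
    (hD : ∀ i, |((j i : ℕ) : ℝ) - (k i : ℕ)| ≤ D) :
    (cellLevel M j : ℝ) + cellLevel M k ≤ 2 * D := by
  have hD1 : 1 ≤ D := by
    obtain ⟨i, hi⟩ := Function.ne_iff.1 hjk
    have hne : ((j i : ℕ) : ℤ) - (k i : ℕ) ≠ 0 := by
      have := Fin.val_ne_of_ne hi
      omega
    have h1 : (1 : ℝ) ≤ |((j i : ℕ) : ℝ) - (k i : ℕ)| := by exact_mod_cast Int.one_le_abs hne
    exact h1.trans (hD i)
  have hk : (cellLevel M k : ℝ) ≤ D := by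
    rcases cellLevel_eq M k with h | ⟨i, hi⟩
    · rw [h]
      simpa using hD1
    · have h1 : (cellLevel M k : ℝ) + M = (k i : ℕ) + 1 := by exact_mod_cast hi
      have h2 : ((j i : ℕ) : ℝ) + 1 ≤ M := by exact_mod_cast mem_blockCells.1 hj i
      linarith [(abs_le.1 (hD i)).1]
  rw [cellLevel_of_mem_blockCells hj]
  push_cast
  linarith

lemma cellSignal_pos [NeZero N] {a e : ℝ} (ha : 0 < a) (j : Fin d → Fin N) :
    0 < cellSignal M a e j := by
  have := cellLevel_div_pos (M := M) (j := j)
  unfold cellSignal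
  positivity

lemma cellSignal_le [NeZero N] {a e : ℝ} (ha : 0 < a) (he : 0 ≤ e) (j : Fin d → Fin N) :
    cellSignal M a e j ≤ a := by
  have h := Real.rpow_le_one (cellLevel_div_pos (M := M) (j := j)).le cellLevel_div_le_one he
  unfold cellSignal
  nlinarith

end Level

/-! ### Smoothness -/

lemma rpow_sub_rpow_le {u v e b : ℝ} (hv0 : 0 ≤ v) (hvu : v ≤ u) (hu1 : u ≤ 1) (he : 0 < e)
    (hb1 : b ≤ 1) (hbe : b ≤ e) : u ^ e - v ^ e ≤ (2 + e) * (u - v) ^ b := by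
  rcases hvu.eq_or_lt with rfl | hlt
  · rw [sub_self]
    positivity
  have hu0 : 0 < u := hv0.trans_lt hlt
  have hd0 : 0 < u - v := by linarith
  have hpos : 0 ≤ (u - v) ^ b := by positivity
  rcases le_total e 1 with he1 | he1
  · have h1 := Real.rpow_add_le_add_rpow hv0 hd0.le he.le he1
    rw [add_sub_cancel] at h1
    have h2 := Real.rpow_le_rpow_of_exponent_ge hd0 (by linarith) hbe
    nlinarith
  · -- Bernoulli's inequality for `(v / u) ^ e`.
    have h1 := one_add_mul_self_le_rpow_one_add (s := v / u - 1)
      (by have : 0 ≤ v / u := by positivity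
          linarith) he1
    rw [add_sub_cancel, Real.div_rpow hv0 hu0.le, le_div_iff₀ (by positivity)] at h1
    have h2 : u ^ e ≤ u := by
      simpa using Real.rpow_le_rpow_of_exponent_ge hu0 hu1 he1
    have h3 := Real.rpow_le_rpow_of_exponent_ge hd0 (by linarith) hb1
    rw [Real.rpow_one] at h3
    have h4 : u * (1 - v / u) = u - v := by field_simp
    have h5 : 0 ≤ 1 - v / u := by
      rw [sub_nonneg, div_le_one hu0]; exact hvu
    have h6 : u ^ e * (1 - v / u) ≤ u - v := h4 ▸ mul_le_mul_of_nonneg_right h2 h5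
    nlinarith [mul_le_mul_of_nonneg_left h6 he.le, mul_le_mul_of_nonneg_left h3 he.le]

lemma abs_rpow_sub_rpow_le {u v e b : ℝ} (hu0 : 0 ≤ u) (hv0 : 0 ≤ v) (hu1 : u ≤ 1) (hv1 : v ≤ 1)
    (he : 0 < e) (hb1 : b ≤ 1) (hbe : b ≤ e) :
    |u ^ e - v ^ e| ≤ (2 + e) * |u - v| ^ b := by
  rcases le_total v u with h | h
  · rw [abs_of_nonneg (sub_nonneg.2 (Real.rpow_le_rpow hv0 h he.le)),
      abs_of_nonneg (sub_nonneg.2 h)]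
    exact rpow_sub_rpow_le hv0 h hu1 he hb1 hbe
  · rw [abs_sub_comm, abs_sub_comm u, abs_of_nonneg (sub_nonneg.2 (Real.rpow_le_rpow hu0 h he.le)),
      abs_of_nonneg (sub_nonneg.2 h)]
    exact rpow_sub_rpow_le hu0 h hv1 he hb1 hbe

lemma rpow_add_rpow_le {u v e b : ℝ} (hu0 : 0 < u) (hv0 : 0 < v) (hu1 : u ≤ 1) (hv1 : v ≤ 1)
    (hb0 : 0 ≤ b) (hbe : b ≤ e) : u ^ e + v ^ e ≤ 2 * (u + v) ^ b := by
  have h1 := Real.rpow_le_rpow_of_exponent_ge hu0 hu1 hbe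
  have h2 := Real.rpow_le_rpow_of_exponent_ge hv0 hv1 hbe
  have h3 := Real.rpow_le_rpow hu0.le (show u ≤ u + v by linarith) hb0
  have h4 := Real.rpow_le_rpow hv0.le (show v ≤ u + v by linarith) hb0
  linarith

/-- The step regression functions are Hölder smooth on the perforated cube, uniformly in the mesh
and in the labels. -/
lemma holderSmoothOn_stepEta {N d M : ℕ} [NeZero N] {a e b C : ℝ} (ha : 0 < a) (he : 0 < e)
    (hb : b ∈ Set.Icc (0 : ℝ) 1) (hbe : b ≤ e) (haC : a * (4 * (2 + e)) ≤ C)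
    (σ : (Fin d → Fin N) → Bool) :
    HolderSmoothOn C b
      (stepEta (gridCell N) (cellSignal M a e) (cubeLabel (blockCells N d M) σ))
      (coreCubes N d) := by
  intro x hx y hy
  have hN : (0 : ℝ) < N := by exact_mod_cast Nat.pos_of_neZero N
  have hD := abs_gridCell_sub_le hx hy
  have hD' : ∀ i, |((gridCell N y i : ℕ) : ℝ) - (gridCell N x i : ℕ)| ≤ 2 * N * ‖x - y‖ :=
    fun i => by rw [abs_sub_comm]; exact hD i
  have hD0 : 0 ≤ 2 * N * ‖x - y‖ := by positivity
  set j := gridCell N x with hj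
  set k := gridCell N y with hk
  set u : ℝ := (cellLevel M j : ℝ) / N with hu
  set v : ℝ := (cellLevel M k : ℝ) / N with hv
  have hu0 : 0 < u := cellLevel_div_pos
  have hv0 : 0 < v := cellLevel_div_pos
  have hu1 : u ≤ 1 := cellLevel_div_le_one
  have hv1 : v ≤ 1 := cellLevel_div_le_one
  have hscale : (4 * ‖x - y‖) ^ b ≤ 4 * ‖x - y‖ ^ b := by
    rw [Real.mul_rpow (by norm_num) (norm_nonneg _)]
    have : (4 : ℝ) ^ b ≤ 4 := by
      simpa using Real.rpow_le_rpow_of_exponent_le (show (1 : ℝ) ≤ 4 by norm_num) hb.2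
    gcongr
  have hfin : ∀ t, t ≤ (2 + e) * (4 * ‖x - y‖) ^ b → a * t ≤ C * ‖x - y‖ ^ b := by
    intro t ht
    calc a * t ≤ a * ((2 + e) * (4 * ‖x - y‖ ^ b)) := by gcongr; exact ht.trans (by gcongr)
      _ = a * (4 * (2 + e)) * ‖x - y‖ ^ b := by ring
      _ ≤ C * ‖x - y‖ ^ b := by gcongr
  have hsame : |u ^ e - v ^ e| ≤ (2 + e) * (4 * ‖x - y‖) ^ b := by
    refine (abs_rpow_sub_rpow_le hu0.le hv0.le hu1 hv1 he hb.2 hbe).trans ?_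
    have h : |u - v| ≤ 4 * ‖x - y‖ := by
      rw [hu, hv, ← sub_div, abs_div, abs_of_pos hN, div_le_iff₀ hN, abs_le]
      have h1 := cellLevel_le_add (M := M) hD0 hD
      have h2 := cellLevel_le_add (M := M) hD0 hD'
      have : 0 ≤ N * ‖x - y‖ := by positivity
      constructor <;> nlinarith
    have := Real.rpow_le_rpow (abs_nonneg _) h hb.1
    gcongr
  have hdiff : (cellLevel M j : ℝ) + cellLevel M k ≤ 2 * (2 * N * ‖x - y‖) →
      u ^ e + v ^ e ≤ (2 + e) * (4 * ‖x - y‖) ^ b := by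
    intro hl
    have h : u + v ≤ 4 * ‖x - y‖ := by
      rw [hu, hv, ← add_div, div_le_iff₀ hN]
      linarith
    have h1 := rpow_add_rpow_le hu0 hv0 hu1 hv1 hb.1 hbe
    have h2 := Real.rpow_le_rpow (by positivity) h hb.1
    nlinarith [show 0 ≤ (u + v) ^ b by positivity]
  have hlab : ∀ {j k : Fin d → Fin N}, cubeLabel (blockCells N d M) σ j ≠
      cubeLabel (blockCells N d M) σ k → j ≠ k ∧ (j ∈ blockCells N d M ∨ k ∈ blockCells N d M) := by
    intro j k h
    refine ⟨fun hjk => h (hjk ▸ rfl), ?_⟩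
    by_contra! hcon
    exact h (by simp [cubeLabel, hcon.1, hcon.2])
  have hsum : cubeLabel (blockCells N d M) σ j ≠ cubeLabel (blockCells N d M) σ k →
      (cellLevel M j : ℝ) + cellLevel M k ≤ 2 * (2 * N * ‖x - y‖) := by
    intro h
    obtain ⟨hne, hjK | hkK⟩ := hlab h
    · exact cellLevel_add_le_of_mem_blockCells hjK hne hD
    · rw [add_comm]
      exact cellLevel_add_le_of_mem_blockCells hkK hne.symm hD'
  simp only [stepEta, cellSignal, ← hj, ← hk, ← hu, ← hv]
  have h₁ := mul_le_mul_of_nonneg_left (le_abs_self (u ^ e - v ^ e)) ha.le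
  have h₂ := mul_le_mul_of_nonneg_left (neg_abs_le (u ^ e - v ^ e)) ha.le
  have haue : 0 < a * u ^ e := by positivity
  have hav : 0 < a * v ^ e := by positivity
  by_cases hl : cubeLabel (blockCells N d M) σ j = cubeLabel (blockCells N d M) σ k
  · have h := hfin _ hsame
    rw [hl, abs_le]
    split_ifs <;> constructor <;> linarith
  · have h := hfin _ (hdiff (hsum hl))
    rw [abs_le]
    split_ifs <;> constructor <;> linarith

/-! ### The noise condition -/

lemma card_filter_add_one_le {N : ℕ} {y : ℝ} (hy : 0 ≤ y) :
    ((Finset.univ.filter fun k : Fin N => ((k : ℕ) : ℝ) + 1 ≤ y).card : ℝ) ≤ y := by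
  have hsub : (Finset.univ.filter fun k : Fin N => ((k : ℕ) : ℝ) + 1 ≤ y)
      ⊆ Finset.univ.filter fun k : Fin N => (k : ℕ) < ⌊y⌋₊ := by
    intro k hk
    simp only [Finset.mem_filter, Finset.mem_univ, true_and] at hk ⊢
    have : (k : ℕ) + 1 ≤ ⌊y⌋₊ := Nat.le_floor (by exact_mod_cast hk)
    omega
  calc ((Finset.univ.filter fun k : Fin N => ((k : ℕ) : ℝ) + 1 ≤ y).card : ℝ)
      ≤ ((Finset.univ.filter fun k : Fin N => (k : ℕ) < ⌊y⌋₊).card : ℝ) := by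
        exact_mod_cast Finset.card_le_card hsub
    _ ≤ ⌊y⌋₊ := by
        rw [Fin.card_filter_val_lt]
        exact_mod_cast min_le_right _ _
    _ ≤ y := Nat.floor_le hy

/-- The noise condition: the block has volume at most `N ^ (-α β)`, and outside of it the signal
grows like the power `β` of the distance to the block. -/
lemma tsybakovNoise_stepEta {N d M : ℕ} [NeZero N] (hd : 1 ≤ d) {a β α C : ℝ} (ha : 0 < a)
    (hβ : 0 < β) (hα : 0 ≤ α) (hαβ : α * β ≤ d)
    (hM : (M : ℝ) / N ≤ (1 / (N : ℝ)) ^ (α * β / d)) (hC : 2 ^ d * a ^ (-α) ≤ C)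
    (s : (Fin d → Fin N) → Bool) :
    TsybakovNoise C α (uniformCore N d) (stepEta (gridCell N) (cellSignal M a β) s) := by
  intro t ht _
  have hP := isProbabilityMeasure_uniformCore N d
  have hN : (0 : ℝ) < N := by exact_mod_cast Nat.pos_of_neZero N
  have hdR : (0 : ℝ) < d := by exact_mod_cast hd
  have hC' : 2 ^ d * (t / a) ^ α ≤ C * t ^ α := by
    calc 2 ^ d * (t / a) ^ α = 2 ^ d * a ^ (-α) * t ^ α := by
          rw [Real.div_rpow ht.le ha.le, Real.rpow_neg ha.le]
          ring
      _ ≤ _ := by gcongr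
  refine le_trans ?_ hC'
  have hset : {x : Feature d | |stepEta (gridCell N) (cellSignal M a β) s x - 1 / 2| < t}
      = gridCell N ⁻¹' {j | cellSignal M a β j < t} := by
    ext x
    simp only [abs_stepEta_sub_half fun j => (cellSignal_pos (M := M) (e := β) ha j).le]
    rfl
  rw [hset]
  -- The radius at which the signal reaches `t`.
  set τ : ℝ := (t / a) ^ (1 / β) with hτ
  have hτ0 : 0 < τ := by positivity
  have hτβ : τ ^ β = t / a := by
    rw [hτ, ← Real.rpow_mul (by positivity), one_div_mul_cancel hβ.ne', Real.rpow_one]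
  have hlt : ∀ j : Fin d → Fin N, cellSignal M a β j < t → (cellLevel M j : ℝ) < τ * N := by
    intro j hj
    rw [← div_lt_iff₀ hN, ← Real.rpow_lt_rpow_iff cellLevel_div_pos.le hτ0.le hβ, hτβ,
      lt_div_iff₀' ha]
    exact hj
  rcases le_or_gt (τ * N) 1 with hsmall | hlarge
  · have hempty : gridCell N ⁻¹' {j | cellSignal M a β j < t} = (∅ : Set (Feature d)) := by
      refine Set.eq_empty_of_forall_notMem fun x hx => ?_
      have h1 := hlt _ hx
      have h2 : (1 : ℝ) ≤ cellLevel M (gridCell N x) := by exact_mod_cast one_le_cellLevel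
      linarith
    rw [hempty, measureReal_empty]
    positivity
  rcases le_or_gt 1 τ with hτ1 | hτ1
  · calc (uniformCore N d).real _ ≤ 1 := measureReal_le_one
      _ ≤ 2 ^ d * (t / a) ^ α := by
          have h1 : (1 : ℝ) ≤ 2 ^ d := one_le_pow₀ (by norm_num)
          have h2 : 1 ≤ (t / a) ^ α := by
            rw [← hτβ]
            exact Real.one_le_rpow (Real.one_le_rpow hτ1 hβ.le) hα
          nlinarith
  · set A : Finset (Fin d → Fin N) := Fintype.piFinset fun _ =>
      Finset.univ.filter fun k : Fin N => ((k : ℕ) : ℝ) + 1 ≤ τ * N + M with hA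
    have hsub : gridCell N ⁻¹' {j | cellSignal M a β j < t}
        ⊆ (gridCell N ⁻¹' (A : Set (Fin d → Fin N)) : Set (Feature d)) := by
      intro x hx
      have h1 := hlt _ hx
      simp only [Set.mem_preimage, Finset.mem_coe, hA, Fintype.mem_piFinset, Finset.mem_filter,
        Finset.mem_univ, true_and]
      intro i
      have h2 : ((gridCell N x i : ℕ) : ℝ) + 1 ≤ cellLevel M (gridCell N x) + M := by
        exact_mod_cast apply_add_one_le_cellLevel i
      linarith
    have hexp : α * β / d ≤ 1 := by
      rw [div_le_one hdR]
      exact hαβ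
    have hexp0 : 0 ≤ α * β / d := by positivity
    calc (uniformCore N d).real _ ≤ A.card * (1 / N) ^ d := by
          rw [← uniformCore_real_gridCell]
          exact measureReal_mono hsub
      _ ≤ (τ * N + M) ^ d * (1 / N) ^ d := by
          rw [hA, Fintype.card_piFinset_const]
          push_cast
          gcongr
          exact card_filter_add_one_le (by positivity)
      _ = (τ + M / N) ^ d := by
          rw [← mul_pow]
          congr 1
          field_simp
      _ ≤ (τ ^ (α * β / d) + τ ^ (α * β / d)) ^ d := by
          gcongr
          · simpa using Real.rpow_le_rpow_of_exponent_ge hτ0 hτ1.le hexp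
          · refine hM.trans (Real.rpow_le_rpow (by positivity) ?_ hexp0)
            rw [div_le_iff₀ hN]
            exact hlarge.le
      _ = 2 ^ d * (t / a) ^ α := by
          rw [← two_mul, mul_pow, ← Real.rpow_natCast (τ ^ _), ← Real.rpow_mul hτ0.le,
            div_mul_cancel₀ _ hdR.ne', mul_comm α, Real.rpow_mul hτ0.le, hτβ]

/-! ### Membership in the class and the minimax bound -/

lemma relativeSignal_stepEta {d : ℕ} {J : Type*} {cell : Feature d → J} {wP wQ : J → ℝ}
    {C γ : ℝ} (hP : ∀ j, 0 ≤ wP j) (hQ : ∀ j, 0 ≤ wQ j) (h : ∀ j, C * wQ j ^ γ ≤ wP j)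
    (s : J → Bool) (Ω : Set (Feature d)) :
    RelativeSignal C γ (stepEta cell wP s) (stepEta cell wQ s) Ω := by
  refine fun x _ => ⟨?_, ?_⟩
  · have := mul_nonneg (hP (cell x)) (hQ (cell x))
    unfold stepEta
    split_ifs <;> linarith
  · rw [abs_stepEta_sub_half hP, abs_stepEta_sub_half hQ]
    exact h _

lemma mem_driftClass {d N M : ℕ} [NeZero N] [IsProbabilityMeasure (uniformCore N d)]
    (hd : 1 ≤ d) {θ : Theta} {a b β : ℝ} (hr : 0 < θ.rLam)
    (hc0 : 0 < θ.cLam) (hc : θ.cLam ≤ min (regularityConst d θ.rLam) ((1 / 4) ^ d))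
    (hα : 0 ≤ θ.α) (hβP : θ.βP ∈ Set.Icc (0 : ℝ) 1) (hβQ : θ.βQ ∈ Set.Icc (0 : ℝ) 1)
    (hγ : 0 < θ.γ) (hβ : 0 < β) (hPβ : θ.βP ≤ θ.γ * β) (hQβ : θ.βQ ≤ β)
    (ha : 0 < a) (haC : a * (4 * (2 + β)) ≤ θ.Cβ) (hb : 0 < b)
    (hbC : b * (4 * (2 + θ.γ * β)) ≤ θ.Cβ)
    (hab : θ.Cγ * a ^ θ.γ ≤ b) (hαβ : θ.α * β ≤ d)
    (hM : (M : ℝ) / N ≤ (1 / (N : ℝ)) ^ (θ.α * β / d)) (hCα : 2 ^ d * a ^ (-θ.α) ≤ θ.Cα)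
    (σ : (Fin d → Fin N) → Bool)
    (hmP : Measurable (stepEta (gridCell N : Feature d → Fin d → Fin N)
      (cellSignal M b (θ.γ * β)) (cubeLabel (blockCells N d M) σ)))
    (hPI : ∀ x, stepEta (gridCell N : Feature d → Fin d → Fin N)
      (cellSignal M b (θ.γ * β)) (cubeLabel (blockCells N d M) σ) x ∈ Set.Icc (0 : ℝ) 1)
    (hmQ : Measurable (stepEta (gridCell N : Feature d → Fin d → Fin N)
      (cellSignal M a β) (cubeLabel (blockCells N d M) σ)))
    (hQI : ∀ x, stepEta (gridCell N : Feature d → Fin d → Fin N)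
      (cellSignal M a β) (cubeLabel (blockCells N d M) σ) x ∈ Set.Icc (0 : ℝ) 1) :
    (obsLaw (uniformCore N d) _ hmP hPI, obsLaw (uniformCore N d) _ hmQ hQI) ∈ DriftClass d θ := by
  have hγβ : 0 < θ.γ * β := by positivity
  refine ⟨coreCubes N d, _, _, isRegressionVersion_obsLaw hmP hPI,
    isRegressionVersion_obsLaw hmQ hQI, ?_, holderSmoothOn_stepEta (M := M) hb hγβ hβP hPβ hbC σ,
    holderSmoothOn_stepEta (M := M) ha hβ hβQ hQβ haC σ, ?_, ?_⟩
  · have hdens := hasDensityBounds_uniformCore (N := N) hd hc0 (hc.trans (min_le_right _ _))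
    constructor
    · exact coreCubes_subset_unitCube N d
    · rw [marginalX_obsLaw, support_uniformCore hd]
    · rw [marginalX_obsLaw, support_uniformCore hd]
    · exact fun x hx r hr0 hrr =>
        coreCubes_regular hd hr (hc.trans (min_le_left _ _)) hx hr0 hrr
    · rwa [marginalX_obsLaw]
    · rwa [marginalX_obsLaw]
  · rw [marginalX_obsLaw]
    exact tsybakovNoise_stepEta hd ha hβ hα hαβ hM hCα _
  · refine relativeSignal_stepEta (fun j => (cellSignal_pos hb j).le)
      (fun j => (cellSignal_pos ha j).le) (fun j => ?_) _ _
    have hu := cellLevel_div_pos (M := M) (j := j)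
    rw [cellSignal, cellSignal, Real.mul_rpow ha.le (by positivity), ← Real.rpow_mul hu.le,
      mul_comm β, ← mul_assoc]
    gcongr

/-- The mesh: `N` is of the order of `n ^ (1 / κ)`. -/
lemma exists_mesh {κ : ℝ} (hκ : 0 < κ) {n : ℕ} (hn : 1 ≤ n) :
    ∃ N : ℕ, 1 ≤ N ∧ (n : ℝ) ≤ (N : ℝ) ^ κ ∧ (N : ℝ) ≤ 2 * (n : ℝ) ^ (1 / κ) := by
  have hnR : (1 : ℝ) ≤ n := by exact_mod_cast hn
  have h1 : 1 ≤ (n : ℝ) ^ (1 / κ) := Real.one_le_rpow hnR (by positivity)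
  refine ⟨⌈(n : ℝ) ^ (1 / κ)⌉₊, Nat.one_le_iff_ne_zero.2 ?_, ?_, ?_⟩
  · rw [Ne, Nat.ceil_eq_zero]
    linarith
  · calc (n : ℝ) = ((n : ℝ) ^ (1 / κ)) ^ κ := by
          rw [← Real.rpow_mul (by linarith), one_div_mul_cancel hκ.ne', Real.rpow_one]
      _ ≤ _ := Real.rpow_le_rpow (by linarith) (Nat.le_ceil _) hκ.le
  · have := Nat.ceil_lt_add_one (show 0 ≤ (n : ℝ) ^ (1 / κ) by linarith)
    linarith

/-- The side of the block: `M / N` is of the order of `N ^ (-ε)`. -/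
lemma exists_block {ε : ℝ} (hε0 : 0 ≤ ε) (hε1 : ε ≤ 1) {N : ℕ} (hN : 1 ≤ N) :
    ∃ M : ℕ, M ≤ N ∧ (M : ℝ) / N ≤ (1 / (N : ℝ)) ^ ε ∧
      (1 / (N : ℝ)) ^ ε / 2 ≤ (M : ℝ) / N := by
  have hNR : (1 : ℝ) ≤ N := by exact_mod_cast hN
  have hN0 : (0 : ℝ) < N := by linarith
  have hx : (1 / (N : ℝ)) ^ ε * N = (N : ℝ) ^ (1 - ε) := by
    rw [one_div, Real.inv_rpow hN0.le, Real.rpow_sub hN0, Real.rpow_one]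
    field_simp
  have hx1 : 1 ≤ (N : ℝ) ^ (1 - ε) := Real.one_le_rpow hNR (by linarith)
  have hfl : (⌊(N : ℝ) ^ (1 - ε)⌋₊ : ℝ) ≤ (N : ℝ) ^ (1 - ε) := Nat.floor_le (by linarith)
  refine ⟨⌊(N : ℝ) ^ (1 - ε)⌋₊, ?_, ?_, ?_⟩
  · have h : (N : ℝ) ^ (1 - ε) ≤ N := by
      simpa using Real.rpow_le_rpow_of_exponent_le hNR (show 1 - ε ≤ 1 by linarith)
    exact_mod_cast hfl.trans h
  · rw [div_le_iff₀ hN0, hx]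
    exact hfl
  · rw [le_div_iff₀ hN0, div_mul_eq_mul_div, hx]
    have h1 := Nat.lt_floor_add_one ((N : ℝ) ^ (1 - ε))
    have h2 : (1 : ℝ) ≤ ⌊(N : ℝ) ^ (1 - ε)⌋₊ := by
      exact_mod_cast Nat.le_floor (by simpa using hx1)
    linarith

/-- The lower bound with the effective smoothness `β` of the target: any exponent for which `β` and
`γ β` dominate the smoothness required of the target and of the source. -/
lemma minimaxExcessRisk_ge {d : ℕ} (hd : 1 ≤ d) {θ : Theta} {a b β : ℝ} (hr : 0 < θ.rLam)
    (hc0 : 0 < θ.cLam) (hc : θ.cLam ≤ min (regularityConst d θ.rLam) ((1 / 4) ^ d))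
    (hα : 0 ≤ θ.α) (hβP : θ.βP ∈ Set.Icc (0 : ℝ) 1) (hβQ : θ.βQ ∈ Set.Icc (0 : ℝ) 1)
    (hγ : 0 < θ.γ) (hβ : 0 < β) (hPβ : θ.βP ≤ θ.γ * β) (hQβ : θ.βQ ≤ β)
    (ha : 0 < a) (ha1 : a ≤ 1 / 2) (haC : a * (4 * (2 + β)) ≤ θ.Cβ)
    (hb : 0 < b) (hb1 : b ≤ 1 / 4) (hbC : b * (4 * (2 + θ.γ * β)) ≤ θ.Cβ)
    (hab : θ.Cγ * a ^ θ.γ ≤ b) (hαβ : θ.α * β ≤ d) (hCα : 2 ^ d * a ^ (-θ.α) ≤ θ.Cα) :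
    ∃ c : ℝ, 0 < c ∧ ∀ n : ℕ, 1 ≤ n →
      ((c * (n : ℝ) ^ (-((1 + θ.α) * β / (2 * θ.γ * β + d))) : ℝ) : EReal)
        ≤ minimaxExcessRisk d n θ := by
  have hdR : (0 : ℝ) < d := by exact_mod_cast hd
  set κ : ℝ := 2 * θ.γ * β + d with hκdef
  have hκ : 0 < κ := by positivity
  set c : ℝ := a * (1 / 2) ^ d / 8 * 2 ^ (-((1 + θ.α) * β)) with hcdef
  refine ⟨c, by positivity, fun n hn => ?_⟩
  obtain ⟨N, hN1, hnN, hNn⟩ := exists_mesh hκ hn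
  have : NeZero N := ⟨by omega⟩
  have hN0 : (0 : ℝ) < N := by exact_mod_cast hN1
  have hnR : (0 : ℝ) < n := by exact_mod_cast hn
  obtain ⟨M, hMN, hMup, hMlow⟩ := exists_block (ε := θ.α * β / d) (by positivity)
    ((div_le_one hdR).2 hαβ) hN1
  have hprob := isProbabilityMeasure_uniformCore N d
  have hγβ : 0 ≤ θ.γ * β := by positivity
  have hb2 : b ≤ 1 / 2 := by linarith
  refine le_iInf fun f => ?_
  -- `n` observations do not detect the label of a cell of the block.
  have hdetect : ∀ j ∈ blockCells N d M,
      n * (4 * cellSignal M b (θ.γ * β) j ^ 2 * (1 / (N : ℝ)) ^ d) ≤ 1 / 2 := by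
    intro j hj
    have hsig : cellSignal M b (θ.γ * β) j ^ 2 * (1 / (N : ℝ)) ^ d
        = b ^ 2 * ((N : ℝ) ^ κ)⁻¹ := by
      rw [cellSignal, cellLevel_of_mem_blockCells hj, Nat.cast_one, mul_pow, mul_assoc]
      congr 1
      rw [← Real.rpow_natCast (_ ^ (θ.γ * β)), ← Real.rpow_mul (by positivity),
        ← Real.rpow_natCast (1 / (N : ℝ)) d, ← Real.rpow_add (by positivity), one_div,
        Real.inv_rpow hN0.le, hκdef]
      congr 3
      push_cast
      ring
    have hle : n * ((N : ℝ) ^ κ)⁻¹ ≤ 1 := by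
      rw [← div_eq_mul_inv, div_le_one (by positivity)]
      exact hnN
    calc n * (4 * cellSignal M b (θ.γ * β) j ^ 2 * (1 / (N : ℝ)) ^ d)
        = 4 * b ^ 2 * (n * ((N : ℝ) ^ κ)⁻¹) := by rw [mul_assoc 4, hsig]; ring
      _ ≤ 4 * b ^ 2 * 1 := by gcongr
      _ ≤ 1 / 2 := by nlinarith
  have hq : ∀ j ∈ blockCells N d M, a * (1 / (N : ℝ)) ^ β ≤ cellSignal M a β j := by
    intro j hj
    rw [cellSignal, cellLevel_of_mem_blockCells hj, Nat.cast_one]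
  have hmass : ∀ j ∈ blockCells N d M,
      (uniformCore N d).real (gridCell N ⁻¹' {j}) = (1 / (N : ℝ)) ^ d := by
    intro j _
    simpa using uniformCore_real_gridCell N d {j}
  obtain ⟨σ, hσ⟩ := exists_excessRisk_ge (ν := uniformCore N d) (measurable_gridCell N d)
    (wP := cellSignal M b (θ.γ * β)) (wQ := cellSignal M a β)
    (fun j => (cellSignal_pos hb j).le) (fun j => (cellSignal_le hb hγβ j).trans hb2)
    (cellSignal_pos ha) (fun j => (cellSignal_le ha hβ.le j).trans ha1)
    hmass hq (by positivity) hdetect f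
  have hcell := measurable_gridCell N d
  have hPI : ∀ x, stepEta (gridCell N : Feature d → Fin d → Fin N) (cellSignal M b (θ.γ * β))
      (cubeLabel (blockCells N d M) σ) x ∈ Set.Icc (0 : ℝ) 1 :=
    stepEta_mem_Icc (fun j => (cellSignal_pos hb j).le) fun j => (cellSignal_le hb hγβ j).trans hb2
  have hQI : ∀ x, stepEta (gridCell N : Feature d → Fin d → Fin N) (cellSignal M a β)
      (cubeLabel (blockCells N d M) σ) x ∈ Set.Icc (0 : ℝ) 1 :=
    stepEta_mem_Icc (fun j => (cellSignal_pos ha j).le) fun j =>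
      (cellSignal_le ha hβ.le j).trans ha1
  refine le_trans ?_ (le_iSup₂_of_le _ (mem_driftClass hd hr hc0 hc hα hβP hβQ hγ hβ hPβ hQβ ha
    haC hb hbC hab hαβ hMup hCα σ (measurable_stepEta hcell) hPI (measurable_stepEta hcell) hQI)
    le_rfl)
  rw [EReal.coe_le_coe_iff]
  refine le_trans ?_ hσ
  rw [card_blockCells hMN]
  calc c * (n : ℝ) ^ (-((1 + θ.α) * β / κ))
      = a * (1 / 2) ^ d / 8 * (2 * (n : ℝ) ^ (1 / κ)) ^ (-((1 + θ.α) * β)) := by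
        rw [hcdef, Real.mul_rpow (by norm_num) (by positivity), ← Real.rpow_mul hnR.le, mul_assoc]
        congr 4
        ring
    _ ≤ a * (1 / 2) ^ d / 8 * (N : ℝ) ^ (-((1 + θ.α) * β)) := by
        refine mul_le_mul_of_nonneg_left ?_ (by positivity)
        exact Real.rpow_le_rpow_of_nonpos hN0 hNn (by
          have : 0 ≤ (1 + θ.α) * β := by positivity
          linarith)
    _ = ((1 / (N : ℝ)) ^ (θ.α * β / d) / 2) ^ d * (a * (1 / (N : ℝ)) ^ β) / 8 := by
        rw [div_pow ((1 / (N : ℝ)) ^ (θ.α * β / d)) 2 d, ← Real.rpow_natCast (_ ^ (θ.α * β / d)),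
          ← Real.rpow_mul (by positivity),
          div_mul_cancel₀ _ hdR.ne', Real.rpow_neg hN0.le, one_div (N : ℝ), Real.inv_rpow hN0.le,
          Real.inv_rpow hN0.le, show (1 + θ.α) * β = θ.α * β + β by ring, Real.rpow_add hN0,
          mul_inv, one_div, inv_pow]
        ring
    _ ≤ ((M : ℝ) / N) ^ d * (a * (1 / (N : ℝ)) ^ β) / 8 := by gcongr
    _ = ((M ^ d : ℕ) : ℝ) * (a * (1 / (N : ℝ)) ^ β * (1 / (N : ℝ)) ^ d / 8) := by
        push_cast
        rw [div_eq_mul_one_div (M : ℝ), mul_pow]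
        ring

theorem theorem2 (d : ℕ) (hd : 1 ≤ d) (rLam : ℝ) (hrLam : 0 < rLam) :
    ∃ c₀ : ℝ, 0 < c₀ ∧
      ∀ α βP βQ γ Cβ Cγ : ℝ, 0 ≤ α → βP ∈ Set.Icc (0 : ℝ) 1 → βQ ∈ Set.Icc (0 : ℝ) 1 →
        0 < max βP βQ → 0 < γ → 0 < Cβ → 0 < Cγ →
      ∃ C₀ : ℝ, 0 < C₀ ∧
        ∀ cLam Cα : ℝ, 0 < cLam → cLam ≤ c₀ → C₀ ≤ Cα →
          ((γ * βQ < βP → α * βP ≤ γ * d →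
              ∃ c : ℝ, 0 < c ∧ ∀ n : ℕ, 1 ≤ n →
                ((c * (n : ℝ) ^ (-((1 + α) * βP / (γ * (2 * βP + d)))) : ℝ) : EReal) ≤
                  minimaxExcessRisk d n ⟨α, βP, βQ, γ, cLam, rLam, Cβ, Cα, Cγ⟩) ∧
            (βP ≤ γ * βQ → α * βQ ≤ d →
              ∃ c : ℝ, 0 < c ∧ ∀ n : ℕ, 1 ≤ n →
                ((c * (n : ℝ) ^ (-((1 + α) * βQ / (2 * γ * βQ + d))) : ℝ) : EReal) ≤
                  minimaxExcessRisk d n ⟨α, βP, βQ, γ, cLam, rLam, Cβ, Cα, Cγ⟩)) := by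
  refine ⟨min (regularityConst d rLam) ((1 / 4) ^ d),
    lt_min (regularityConst_pos hd hrLam) (by positivity), ?_⟩
  intro α βP βQ γ Cβ Cγ hα hβP hβQ hmax hγ hCβ hCγ
  set β : ℝ := max (βP / γ) βQ with hβdef
  have hβ : 0 < β := by
    rcases lt_max_iff.1 hmax with h | h
    · exact lt_max_of_lt_left (by positivity)
    · exact lt_max_of_lt_right h
  have hPβ : βP ≤ γ * β := by
    rw [← div_le_iff₀' hγ]
    exact le_max_left _ _
  have hQβ : βQ ≤ β := le_max_right _ _
  -- The amplitudes `b` of the source signal and `a` of the target signal.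
  set b : ℝ := min (1 / 4) (Cβ / (4 * (2 + γ * β))) with hbdef
  have hb : 0 < b := by positivity
  have hb1 : b ≤ 1 / 4 := min_le_left _ _
  have hbC : b * (4 * (2 + γ * β)) ≤ Cβ := by
    rw [← le_div_iff₀ (by positivity)]
    exact min_le_right _ _
  set a : ℝ := min (1 / 2) (min (Cβ / (4 * (2 + β))) ((b / Cγ) ^ (1 / γ))) with hadef
  have ha : 0 < a := by positivity
  have ha1 : a ≤ 1 / 2 := min_le_left _ _
  have haC : a * (4 * (2 + β)) ≤ Cβ := by
    rw [← le_div_iff₀ (by positivity)]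
    exact (min_le_right _ _).trans (min_le_left _ _)
  have hab : Cγ * a ^ γ ≤ b := by
    have h1 : a ≤ (b / Cγ) ^ (1 / γ) := (min_le_right _ _).trans (min_le_right _ _)
    have h2 := Real.rpow_le_rpow ha.le h1 hγ.le
    rw [← Real.rpow_mul (by positivity), one_div_mul_cancel hγ.ne', Real.rpow_one,
      le_div_iff₀' hCγ] at h2
    exact h2
  refine ⟨2 ^ d * a ^ (-α), by positivity, ?_⟩
  intro cLam Cα hc0 hc hCα
  have key := fun hαβ => minimaxExcessRisk_ge (θ := ⟨α, βP, βQ, γ, cLam, rLam, Cβ, Cα, Cγ⟩) hd hrLam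
    hc0 hc hα hβP hβQ hγ hβ hPβ hQβ ha ha1 haC hb hb1 hbC hab hαβ hCα
  dsimp only at key
  constructor
  · intro hlt hαP
    have hβeq : β = βP / γ := max_eq_left (by rw [le_div_iff₀' hγ]; exact hlt.le)
    have hrate : (1 + α) * β / (2 * γ * β + d) = (1 + α) * βP / (γ * (2 * βP + d)) := by
      have : 0 < 2 * βP + d := by
        have : (0 : ℝ) < d := by exact_mod_cast hd
        linarith [hβP.1]
      rw [hβeq, show 2 * γ * (βP / γ) + d = 2 * βP + d by field_simp]
      field_simp
    rw [← hrate]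
    refine key ?_
    rw [hβeq, mul_div_assoc', div_le_iff₀' hγ]
    exact hαP
  · intro hle hαQ
    have hβeq : β = βQ := max_eq_right (by rw [div_le_iff₀' hγ]; exact hle)
    rw [hβeq] at key
    exact key hαQ
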